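/- All graphs are finite and simple. For a graph $G$, let $I(G,x)=\sum_{k=0}^{\alpha(G)} s(G,k)x^k$ be its independence polynomial, where $s(G,k)$ is the number of independent sets of $G$ of size $k$ and $\alpha(G)$ is the independence number, and let $\xi(G)$ be the largest real root of $I(G,x)$ (which exists whenever $G$ has at least one vertex). Write $G\succeq H$ if $I(H,x)\ge I(G,x)$ for every $x\in[\xi(G),0]$. For $1\le k\le n-1$, let $H_{n,k}$ be the double star of order $n$ consisting of two adjacent vertices, one with $k-1$ and the other with $n-k-1$ further neighbours, all of these being leaves. For $n_1,\dots,n_k\ge 2$, let $T(n_1,\dots,n_k)$ be the tree consisting of a vertex $v$ of degree $k$ joined to one end of each of $k$ disjoint paths with $n_1-1,\dots,n_k-1$ vertices, and for $1\le k\le n-1$ let $T_{n,k}=T(n-k+1,\underbrace{2,\dots,2}_{k-1})$. **Theorem.** Let $T$ be a tree of order $n\ge 2$ with maximum degree $k$. Then $$H_{n,k}\succeq T\succeq T_{n,k}.$$ Moreover, $I(H_{n,k},x)=I(T,x)$ if and only if $T$ is isomorphic to $H_{n,k}$, and $I(T,x)=I(T_{n,k},x)$ if and only if $T$ is isomorphic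 to $T_{n,k}$. -/

import Mathlib

/-- The independence polynomial `I(G, x) = ∑_{k = 0}^{α(G)} s(G, k) x ^ k` of a finite simple graph,
where `s(G, k)` is the number of independent sets of size `k`. -/
noncomputable def indepPoly {V : Type*} [Finite V] (G : SimpleGraph V) : Polynomial ℝ :=
  ∑ k ∈ Finset.range (G.indepNum + 1),
    Polynomial.C ((G.indepSetSet k).ncard : ℝ) * Polynomial.X ^ k

/-- `ξ` is the largest real root of the independence polynomial of `G`. -/
def IsLargestRoot {V : Type*} [Finite V] (G : SimpleGraph V) (ξ : ℝ) : Prop :=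
  IsGreatest {x : ℝ | (indepPoly G).IsRoot x} ξ

/-- `G ⪰ H`: the polynomial `I(G, x)` has a largest real root `ξ(G)`, and `I(H, x) ≥ I(G, x)` for
every `x ∈ [ξ(G), 0]`. -/
def IndepGE {V W : Type*} [Finite V] [Finite W] (G : SimpleGraph V) (H : SimpleGraph W) : Prop :=
  ∃ ξ : ℝ, IsLargestRoot G ξ ∧
    ∀ x ∈ Set.Icc ξ 0, (indepPoly G).eval x ≤ (indepPoly H).eval x

/-- The tree `T(m 0, …, m (k - 1))` (all `m i ≥ 2`): a vertex `none` of degree `k` joined to one end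
of each of `k` disjoint paths, the `i`-th path having the `m i - 1` vertices
`⟨i, 0⟩, ⟨i, 1⟩, …` in this order. -/
def starlike {k : ℕ} (m : Fin k → ℕ) : SimpleGraph (Option (Σ i : Fin k, Fin (m i - 1))) :=
  SimpleGraph.fromRel fun a b =>
    match a, b with
    | none, some q => q.2.val = 0
    | some p, some q => p.1 = q.1 ∧ p.2.val + 1 = q.2.val
    | _, none => False

/-- The arm lengths `(n - k + 1, 2, …, 2)`, with `k` entries. -/
def longArm (n k : ℕ) : Fin k → ℕ := fun i => if i.val = 0 then n - k + 1 else 2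

/-- The tree `T_{n,k} = T(n - k + 1, 2, …, 2)`, for `1 ≤ k ≤ n - 1`. -/
def treeT (n k : ℕ) : SimpleGraph (Option (Σ i : Fin k, Fin (longArm n k i - 1))) :=
  starlike (longArm n k)

/-- The double star: two adjacent centres `inl false` and `inl true`, with `a` leaves attached to
the first one and `b` leaves attached to the second one. -/
def doubleStar (a b : ℕ) : SimpleGraph (Bool ⊕ (Fin a ⊕ Fin b)) :=
  SimpleGraph.fromRel fun x y =>
    match x, y with
    | .inl false, .inl true => True
    | .inl false, .inr (.inl _) => True
    | .inl true, .inr (.inr _) => True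
    | _, _ => False

/-- The tree `H_{n,k}`, for `1 ≤ k ≤ n - 1`: the two adjacent centres have `k - 1` and `n - k - 1`
leaves attached to them. -/
def treeH (n k : ℕ) : SimpleGraph (Bool ⊕ (Fin (k - 1) ⊕ Fin (n - k - 1))) :=
  doubleStar (k - 1) (n - k - 1)

/-! Root the tree at a vertex of maximum degree `k` and let `f` be the forest below the root, so
that `deg f = k` and `inner f = n - k - 1`. With `t = -x`, the independence polynomial becomes `tree
t f = full t f - t * low t f`. Constructing `cons c r` adds one edge, whose ends carry the forests
`r` and `c`; this gives the recursion for `full` and `low`, and makes induction on plane forests an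
induction over edges. Left of the first zero of `tree · f`, all subtrees have positive values
(`pos_of_tree_pos`), so inequalities between factors can be multiplied.

Lower bound: put `y = 1 - t`. A forest satisfies `low ≤ y ^ inner` and `full ≥ y ^ (deg - 1) * (y ^
inner - t)`, the second because merging two stars into a larger star and an isolated vertex
decreases the product of values (`star_merge`). Both bounds are attained by the double star
(`lower_vals`).

Upper bound: replacing a rooted tree by a path rooted at an end increases both its value and the
ratio `full / low` (`path_compare`). By `interpolate`, these two facts control every combination `u
* full - w * low` that occurs when the rest of the tree is fixed. Once the branches are paths, two
of them are replaced by one long path and an isolated vertex, at a loss governed by `defect`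
(`long_compare`).

The equality cases need the equality of values at a single small `t > 0`. They determine the forest
up to the order of its trees, except that a path rooted at an inner vertex also attains the upper
bound; it is rerooted in `two_paths`. -/

/-- A plane forest in first-child / next-sibling form: `cons c r` is the forest whose first tree has
a root with the forest `c` of children below it, and whose other trees form `r`. -/
inductive PlaneForest : Type
  | nil : PlaneForest
  | cons : PlaneForest → PlaneForest → PlaneForest

/-! ### Rooted trees as plane forests -/

namespace PlaneForest

/-- The number of vertices. -/
def size : PlaneForest → ℕ
  | nil => 0
  | cons c r => size c + 1 + size r

/-- The number of trees. -/
def deg : PlaneForest → ℕ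
  | nil => 0
  | cons _ r => deg r + 1

/-- The number of vertices which are not roots. -/
def inner : PlaneForest → ℕ
  | nil => 0
  | cons c r => size c + inner r

/-- The forest of `j` isolated vertices. -/
def nils : ℕ → PlaneForest
  | 0 => nil
  | j + 1 => cons nil (nils j)

/-- The forest consisting of a path with `m` vertices rooted at an end (empty for `m = 0`). -/
def path : ℕ → PlaneForest
  | 0 => nil
  | m + 1 => cons (path m) nil

/-- All trees of the forest are single vertices, except possibly one, which is `d` below a root. -/
inductive OneLong (d : PlaneForest) : PlaneForest → Prop
  | here (j : ℕ) : OneLong d (cons d (nils j))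
  | there {r : PlaneForest} : OneLong d r → OneLong d (cons nil r)

/-- The values at `-t` of the independence polynomials of a forest and of the forest without its
roots. -/
noncomputable def vals (t : ℝ) : PlaneForest → ℝ × ℝ
  | nil => (1, 1)
  | cons c r => (((vals t c).1 - t * (vals t c).2) * (vals t r).1, (vals t c).1 * (vals t r).2)

/-- The value at `-t` of the independence polynomial of a forest. -/
noncomputable def full (t : ℝ) (f : PlaneForest) : ℝ := (vals t f).1

/-- The value at `-t` of the independence polynomial of a forest without its roots. -/
noncomputable def low (t : ℝ) (f : PlaneForest) : ℝ := (vals t f).2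

/-- The value at `-t` of the independence polynomial of the tree obtained by joining a new vertex to
all roots. -/
noncomputable def tree (t : ℝ) (f : PlaneForest) : ℝ := full t f - t * low t f

variable {t : ℝ}

@[simp] lemma full_nil : full t nil = 1 := rfl
@[simp] lemma low_nil : low t nil = 1 := rfl
@[simp] lemma full_cons (c r : PlaneForest) :
    full t (cons c r) = (full t c - t * low t c) * full t r := rfl
@[simp] lemma low_cons (c r : PlaneForest) : low t (cons c r) = full t c * low t r := rfl

@[simp] lemma full_nils (j : ℕ) : full t (nils j) = (1 - t) ^ j := by
  induction j with
  | zero => simp [nils]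
  | succ j ih => simp [nils, ih, pow_succ']

@[simp] lemma low_nils (j : ℕ) : low t (nils j) = 1 := by
  induction j with
  | zero => simp [nils]
  | succ j ih => simp [nils, ih]

@[simp] lemma deg_nils (j : ℕ) : deg (nils j) = j := by
  induction j with
  | zero => rfl
  | succ j ih => exact congrArg (· + 1) ih

@[simp] lemma size_path (m : ℕ) : size (path m) = m := by
  induction m with
  | zero => simp [path, size]
  | succ m ih => simp [path, size, ih]

lemma size_eq (f : PlaneForest) : size f = deg f + inner f := by
  induction f with
  | nil => rfl
  | cons c r _ ih => simp only [size, deg, inner, ih]; omega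

lemma eq_nil_of_size {f : PlaneForest} (h : size f = 0) : f = nil := by
  cases f with
  | nil => rfl
  | cons c r => simp [size] at h

lemma eq_nils_of_inner {f : PlaneForest} (h : inner f = 0) : f = nils (deg f) := by
  induction f with
  | nil => rfl
  | cons c r _ ih =>
    simp only [inner, Nat.add_eq_zero_iff] at h
    rw [deg, nils, ← ih h.2, eq_nil_of_size h.1]

lemma OneLong.eq_nils {f : PlaneForest} (h : OneLong nil f) : f = nils (deg f) := by
  induction h with
  | here j =>
    change nils (j + 1) = nils (deg (nils j) + 1)
    rw [deg_nils]
  | there _ ih => rw [deg, nils, ← ih]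

/-! ### Forests with positive values -/

/-- Every tree of the forest has a positive value at `-t`, and so do all its subtrees. -/
def Pos (t : ℝ) : PlaneForest → Prop
  | nil => True
  | cons c r => 0 < tree t c ∧ Pos t c ∧ Pos t r

lemma Pos.full_pos {f : PlaneForest} (h : Pos t f) : 0 < full t f := by
  induction f with
  | nil => simp
  | cons c r _ ih => exact mul_pos h.1 (ih h.2.2)

lemma Pos.low_pos {f : PlaneForest} (h : Pos t f) : 0 < low t f := by
  induction f with
  | nil => simp
  | cons c r _ ih => exact mul_pos h.2.1.full_pos (ih h.2.2)

lemma Pos.full_le_low {f : PlaneForest} (ht : 0 ≤ t) (h : Pos t f) : full t f ≤ low t f := by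
  induction f with
  | nil => simp
  | cons c r _ ih =>
    refine mul_le_mul ?_ (ih h.2.2) h.2.2.full_pos.le h.2.1.full_pos.le
    exact sub_le_self _ (mul_nonneg ht h.2.1.low_pos.le)

/-- One tree suffices for the factor `1 - t`: since `full t c ≤ low t c`, its value is at most `(1 -
t) * full t c`. -/
lemma Pos.full_le {f : PlaneForest} (ht : 0 ≤ t) (h : Pos t f) (hf : f ≠ nil) :
    full t f ≤ (1 - t) * low t f := by
  cases f with
  | nil => exact absurd rfl hf
  | cons c r =>
    have h1 := h.2.2.full_le_low ht
    have h2 := h.2.1.full_le_low ht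
    have h3 : full t c - t * low t c ≤ (1 - t) * full t c := by nlinarith
    have h4 : 0 ≤ full t c - t * low t c := h.1.le
    calc (full t c - t * low t c) * full t r ≤ ((1 - t) * full t c) * low t r :=
          mul_le_mul h3 h1 h.2.2.full_pos.le (h4.trans h3)
      _ = _ := by simp [mul_assoc]

/-! ### Positivity of all subtrees from positivity of the whole tree -/

lemma continuous_full (f : PlaneForest) :
    Continuous (fun t => full t f) ∧ Continuous (fun t => low t f) := by
  induction f with
  | nil => exact ⟨continuous_const, continuous_const⟩
  | cons c r hc hr =>
    exact ⟨(hc.1.sub (continuous_id.mul hc.2)).mul hr.1, hc.1.mul hr.2⟩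

lemma continuous_tree (f : PlaneForest) : Continuous (fun t => tree t f) :=
  (continuous_full f).1.sub (continuous_id.mul (continuous_full f).2)

lemma nonneg_of_pos_Ico {g : ℝ → ℝ} (hg : Continuous g) {s : ℝ} (hs : 0 < s)
    (h : ∀ x ∈ Set.Ico 0 s, 0 < g x) : 0 ≤ g s := by
  have h1 : s ∈ closure (Set.Ico 0 s) := by
    rw [closure_Ico hs.ne]; exact ⟨hs.le, le_rfl⟩
  have h2 : closure (Set.Ico 0 s) ⊆ {x | 0 ≤ g x} :=
    closure_minimal (fun x hx => (h x hx).le) (isClosed_le continuous_const hg)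
  exact h2 h1

lemma vals_zero (f : PlaneForest) : full 0 f = 1 ∧ low 0 f = 1 := by
  induction f with
  | nil => simp
  | cons c r hc hr => simp [hc, hr]

/-- The edge between the root and its first child splits the tree into two, with forests `c` and
`r`. At the first point where one of the two values is nonpositive, all other quantities are
nonnegative by continuity, and the value of the whole tree would be nonpositive. -/
lemma pos_of_tree_pos (f : PlaneForest) (ht : 0 ≤ t) (h : ∀ s ∈ Set.Icc 0 t, 0 < tree s f) :
    Pos t f := by
  induction f generalizing t with
  | nil => trivial
  | cons c r hc hr =>
    have key : ∀ s ∈ Set.Icc 0 t, 0 < tree s c ∧ 0 < tree s r := by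
      by_contra! hcon
      have hne : (Set.Icc 0 t ∩ {s | tree s c ≤ 0 ∨ tree s r ≤ 0}).Nonempty := by
        obtain ⟨s, hs, h1⟩ := hcon
        refine ⟨s, hs, ?_⟩
        by_cases h2 : 0 < tree s c
        · exact Or.inr (h1 h2)
        · exact Or.inl (not_lt.1 h2)
      have hcpt : IsCompact (Set.Icc 0 t ∩ {s | tree s c ≤ 0 ∨ tree s r ≤ 0}) :=
        isCompact_Icc.inter_right
          ((isClosed_le (continuous_tree c) continuous_const).union
            (isClosed_le (continuous_tree r) continuous_const))
      obtain ⟨s, ⟨hs, hbad⟩, hmin⟩ := hcpt.exists_isLeast hne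
      have hs0 : 0 < s := by
        rcases hs.1.lt_or_eq with h1 | rfl
        · exact h1
        · simp [tree, vals_zero] at hbad
          exact absurd hbad (by norm_num)
      have hgood : ∀ x ∈ Set.Ico 0 s, 0 < tree x c ∧ 0 < tree x r := by
        intro x hx
        by_contra hx'
        have : s ≤ x := hmin ⟨⟨hx.1, hx.2.le.trans hs.2⟩, by
          by_contra h2
          simp only [Set.mem_ofPred_eq, not_or, not_le] at h2
          exact hx' h2⟩
        exact absurd hx.2 (not_lt.2 this)
      have hpc : ∀ x ∈ Set.Ico 0 s, Pos x c := fun x hx =>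
        hc hx.1 fun y hy => (hgood y ⟨hy.1, hy.2.trans_lt hx.2⟩).1
      have hpr : ∀ x ∈ Set.Ico 0 s, Pos x r := fun x hx =>
        hr hx.1 fun y hy => (hgood y ⟨hy.1, hy.2.trans_lt hx.2⟩).2
      have ac := nonneg_of_pos_Ico (continuous_full c).1 hs0 fun x hx => (hpc x hx).full_pos
      have bc := nonneg_of_pos_Ico (continuous_full c).2 hs0 fun x hx => (hpc x hx).low_pos
      have ar := nonneg_of_pos_Ico (continuous_full r).1 hs0 fun x hx => (hpr x hx).full_pos
      have br := nonneg_of_pos_Ico (continuous_full r).2 hs0 fun x hx => (hpr x hx).low_pos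
      have hf : 0 < (full s c - s * low s c) * full s r - s * (full s c * low s r) := h s hs
      have h1 := mul_nonneg hs0.le (mul_nonneg ac br)
      rcases hbad with hb | hb
      · have h2 : (full s c - s * low s c) * full s r ≤ 0 :=
          mul_nonpos_of_nonpos_of_nonneg hb ar
        linarith
      · have h2 : full s c * (full s r - s * low s r) ≤ 0 :=
          mul_nonpos_of_nonneg_of_nonpos ac hb
        have h3 := mul_nonneg hs0.le (mul_nonneg bc ar)
        linarith
    exact ⟨(key t ⟨ht, le_rfl⟩).1, hc ht fun s hs => (key s hs).1, hr ht fun s hs => (key s hs).2⟩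

lemma exists_tree_nonpos {f : PlaneForest} (hf : f ≠ nil) :
    ∃ s ∈ Set.Icc (0 : ℝ) (1 / 2), tree s f ≤ 0 := by
  by_contra! h
  have hp := pos_of_tree_pos f (by norm_num : (0 : ℝ) ≤ 1 / 2) h
  have h1 := hp.full_le (by norm_num) hf
  have h2 := h (1 / 2) ⟨by norm_num, le_rfl⟩
  simp only [tree] at h2
  linarith

lemma one_le_vals (ht : t ≤ 0) (f : PlaneForest) : 1 ≤ full t f ∧ 1 ≤ low t f := by
  induction f with
  | nil => simp
  | cons c r hc hr =>
    refine ⟨one_le_mul_of_one_le_of_one_le ?_ hr.1, one_le_mul_of_one_le_of_one_le hc.1 hr.2⟩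
    have := mul_nonneg (neg_nonneg.2 ht) (zero_le_one.trans hc.2)
    change 1 ≤ full t c - t * low t c
    linarith [hc.1]

lemma tree_pos_of_nonpos (ht : t ≤ 0) (f : PlaneForest) : 0 < tree t f := by
  obtain ⟨h1, h2⟩ := one_le_vals ht f
  have := mul_nonneg (neg_nonneg.2 ht) (zero_le_one.trans h2)
  rw [tree]; linarith

/-! ### The lower bound -/

lemma full_eq_of_low (ht : 0 < t) {f : PlaneForest} (h : Pos t f) (hle : low t f ≤ full t f) :
    f = nil := by
  by_contra hf
  have h1 := h.full_le ht.le hf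
  have := mul_pos ht h.low_pos
  linarith

lemma tree_le_mul_full (ht : 0 ≤ t) {f : PlaneForest} (h : Pos t f) :
    tree t f ≤ (1 - t) * full t f := by
  have := mul_le_mul_of_nonneg_left (h.full_le_low ht) ht
  rw [tree]; linarith

/-- `(1 - t) ^ s - t` is the value of a star with `s` leaves. The last term is the gain of two stars
over one merged star and an isolated vertex; for `0 < t < 1` it vanishes only if `s = 0` or `g = 0`.
-/
lemma star_merge (s g : ℕ) : ((1 - t) ^ s - t) * ((1 - t) ^ g - t) =
    (1 - t) * ((1 - t) ^ (s + g) - t) + t * (1 - (1 - t) ^ s) * (1 - (1 - t) ^ g) := by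
  rw [pow_add]; ring

/-- The upper bounds come from deleting edges below the roots, the lower bound from replacing each
tree by a star and merging the stars. The hypothesis says that the fully merged star still has a
positive value; it passes to all subforests. -/
lemma lower_vals (ht : 0 < t) (ht1 : t < 1) (f : PlaneForest) (h : t < (1 - t) ^ inner f) :
    Pos t f ∧ full t f ≤ (1 - t) ^ size f ∧ low t f ≤ (1 - t) ^ inner f ∧
      (f ≠ nil → (1 - t) ^ (deg f - 1) * ((1 - t) ^ inner f - t) ≤ full t f) := by
  have hy0 : 0 < 1 - t := by linarith
  have hy1 : 1 - t ≤ 1 := by linarith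
  have hpow : ∀ m : ℕ, (1 - t) ^ m ≤ 1 := fun m => pow_le_one₀ hy0.le hy1
  induction f with
  | nil => simp [Pos, size, inner]
  | cons c r hc hr =>
    have hs : t < (1 - t) ^ size c :=
      h.trans_le (pow_le_pow_of_le_one hy0.le hy1 (by simp [inner]))
    have hg : t < (1 - t) ^ inner r :=
      h.trans_le (pow_le_pow_of_le_one hy0.le hy1 (by simp [inner]))
    obtain ⟨c1, c2, c3, c4⟩ := hc (hs.trans_le
      (pow_le_pow_of_le_one hy0.le hy1 (by rw [size_eq]; omega)))
    obtain ⟨r1, r2, r3, r4⟩ := hr hg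
    have hstar : (1 - t) ^ size c - t ≤ full t c - t * low t c := by
      cases c with
      | nil => simp [size]
      | cons d e =>
        have h1 := c4 (by simp)
        have h2 := mul_le_mul_of_nonneg_left c3 ht.le
        set y := 1 - t with hy
        -- This is the difference between the double star bound for the tree with forest `c` and the
        -- value of a star of the same order.
        have h3 : 0 ≤ t * (1 - y ^ deg e) * (1 - y ^ inner (cons d e)) :=
          mul_nonneg (mul_nonneg ht.le (by linarith [hpow (deg e)]))
            (by linarith [hpow (inner (cons d e))])
        have h4 : y ^ size (cons d e) = y * (y ^ deg e * y ^ inner (cons d e)) := by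
          rw [size_eq, deg]; ring
        have h5 : deg (cons d e) - 1 = deg e := by simp [deg]
        rw [h5] at h1
        have h6 : y * (y ^ deg e * y ^ inner (cons d e))
          = (y ^ deg e * y ^ inner (cons d e)) - t * (y ^ deg e * y ^ inner (cons d e)) := by
          rw [hy]; ring
        rw [h4, h6]
        linarith
    have hpos : 0 < tree t c := (sub_pos.2 hs).trans_le hstar
    refine ⟨⟨hpos, c1, r1⟩, ?_, ?_, fun _ => ?_⟩
    · calc tree t c * full t r ≤ ((1 - t) * (1 - t) ^ size c) * (1 - t) ^ size r :=
            mul_le_mul ((tree_le_mul_full ht.le c1).trans (mul_le_mul_of_nonneg_left c2 hy0.le)) r2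
              r1.full_pos.le (by positivity)
        _ = _ := by rw [size]; ring
    · calc full t c * low t r ≤ (1 - t) ^ size c * (1 - t) ^ inner r :=
            mul_le_mul c2 r3 r1.low_pos.le (by positivity)
        _ = _ := by rw [inner, pow_add]
    · cases r with
      | nil => simpa [deg, inner] using hstar
      | cons d e =>
        have h1 := r4 (by simp)
        have h2 := mul_le_mul hstar h1
          (mul_nonneg (by positivity) (sub_nonneg.2 hg.le)) hpos.le
        have h3 : 0 ≤ t * (1 - (1 - t) ^ size c) * (1 - (1 - t) ^ inner (cons d e)) :=
          mul_nonneg (mul_nonneg ht.le (by linarith [hpow (size c)]))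
            (by linarith [hpow (inner (cons d e))])
        refine le_trans ?_ h2
        have h5 : ∀ d e, deg (cons d e) - 1 = deg e := fun d e => by simp [deg]
        rw [h5, h5, mul_left_comm, star_merge, ← inner.eq_2]
        have h6 : deg (cons d e) = deg e + 1 := rfl
        have h7 := mul_nonneg (pow_nonneg hy0.le (deg e)) h3
        rw [h6, pow_succ]
        linarith

/-- Equality must hold in every factor, so `tree t c = (1 - t) * full t c`. Then `low t c ≤ full t
c`, which only the empty forest allows. -/
lemma eq_nils_of_full (ht : 0 < t) (ht1 : t < 1) (f : PlaneForest) (h : t < (1 - t) ^ inner f)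
    (hf : full t f = (1 - t) ^ size f) : f = nils (size f) := by
  have hy0 : 0 < 1 - t := by linarith
  have hy1 : 1 - t ≤ 1 := by linarith
  induction f with
  | nil => rfl
  | cons c r hc hr =>
    have hs : t < (1 - t) ^ inner c :=
      h.trans_le (pow_le_pow_of_le_one hy0.le hy1 (by have := size_eq c; simp only [inner]; omega))
    have hg : t < (1 - t) ^ inner r :=
      h.trans_le (pow_le_pow_of_le_one hy0.le hy1 (by simp [inner]))
    obtain ⟨c1, c2, c3, c4⟩ := lower_vals ht ht1 c hs
    obtain ⟨r1, r2, r3, r4⟩ := lower_vals ht ht1 r hg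
    obtain ⟨⟨hp, -⟩, -⟩ := lower_vals ht ht1 _ h
    have h1 := tree_le_mul_full ht.le c1
    have h2 := mul_le_mul_of_nonneg_left c2 hy0.le
    have h3 : tree t c * full t r = ((1 - t) * (1 - t) ^ size c) * (1 - t) ^ size r := by
      change full t (cons c r) = _
      rw [hf, size]; ring
    have h4 : 0 < (1 - t) * (1 - t) ^ size c := by positivity
    have h5 : tree t c = (1 - t) * (1 - t) ^ size c := by
      refine le_antisymm (h1.trans h2) ?_
      by_contra! h6
      exact absurd h3 (mul_lt_mul h6 r2 r1.full_pos h4.le).ne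
    have h6 : full t r = (1 - t) ^ size r := by
      rw [h5] at h3
      exact mul_left_cancel₀ h4.ne' h3
    have h7 : c = nil := by
      refine full_eq_of_low ht c1 ?_
      have h8 : (1 - t) * full t c ≤ tree t c := by rw [h5]; exact h2
      rw [tree] at h8
      exact le_of_mul_le_mul_left (by linarith) ht
    rw [h7, size, size, zero_add, add_comm, nils, ← hr hg h6]

lemma mul_eq_of_le {x y X Y : ℝ} (hx : x ≤ X) (hy : y ≤ Y) (hy0 : 0 < y) (hX : 0 < X)
    (h : x * y = X * Y) : x = X ∧ y = Y := by
  have h1 : x = X := by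
    refine le_antisymm hx ?_
    by_contra! h6
    exact absurd h (mul_lt_mul h6 hy hy0 hX.le).ne
  subst h1
  exact ⟨rfl, mul_left_cancel₀ hX.ne' h⟩

/-- Equality for `low` makes the forest below each root edgeless; equality for `full` kills every
gain in `star_merge`, so at most one root has vertices below it. -/
lemma oneLong_nils_of_eq (ht : 0 < t) (ht1 : t < 1) (f : PlaneForest) (hf : f ≠ nil)
    (h : t < (1 - t) ^ inner f) (h1 : low t f = (1 - t) ^ inner f)
    (h2 : full t f = (1 - t) ^ (deg f - 1) * ((1 - t) ^ inner f - t)) :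
    OneLong (nils (inner f)) f := by
  have hy0 : 0 < 1 - t := by linarith
  have hy1 : 1 - t ≤ 1 := by linarith
  induction f with
  | nil => exact absurd rfl hf
  | cons c r _ hr =>
    have hs' : t < (1 - t) ^ size c :=
      h.trans_le (pow_le_pow_of_le_one hy0.le hy1 (by simp [inner]))
    have hs : t < (1 - t) ^ inner c :=
      h.trans_le (pow_le_pow_of_le_one hy0.le hy1 (by have := size_eq c; simp only [inner]; omega))
    have hg : t < (1 - t) ^ inner r :=
      h.trans_le (pow_le_pow_of_le_one hy0.le hy1 (by simp [inner]))
    obtain ⟨c1, c2, c3, c4⟩ := lower_vals ht ht1 c hs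
    obtain ⟨r1, r2, r3, r4⟩ := lower_vals ht ht1 r hg
    obtain ⟨h3, h4⟩ := mul_eq_of_le c2 r3 r1.low_pos (by positivity)
      (by rw [← pow_add]; exact h1)
    have hc := eq_nils_of_full ht ht1 c hs h3
    have hfc : full t c - t * low t c = (1 - t) ^ size c - t := by
      rw [h3, hc]; simp
    cases r with
    | nil => rw [inner, inner, add_zero, ← hc]; exact OneLong.here 0
    | cons d e =>
      have h5 := r4 (by simp)
      have h6 : ∀ d e, deg (cons d e) - 1 = deg e := fun d e => by simp [deg]
      have hy : ∀ m, 0 ≤ 1 - (1 - t) ^ m := fun m => sub_nonneg.2 (pow_le_one₀ hy0.le hy1)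
      rw [h6] at h5 h2
      have h7 : ((1 - t) ^ size c - t) * full t (cons d e) = (1 - t) ^ deg (cons d e) *
          ((1 - t) ^ (size c + inner (cons d e)) - t) := by
        rw [← hfc]; exact h2
      have h8 := mul_le_mul_of_nonneg_left h5 (sub_nonneg.2 hs'.le)
      rw [mul_left_comm, star_merge] at h8
      have hK : 0 < (1 - t) ^ deg e := by positivity
      have h9 : (1 - t) ^ deg (cons d e) = (1 - t) ^ deg e * (1 - t) := rfl
      have h10 : t * (1 - (1 - t) ^ size c) * (1 - (1 - t) ^ inner (cons d e)) = 0 := by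
        refine le_antisymm ?_ (mul_nonneg (mul_nonneg ht.le (hy _)) (hy _))
        refine le_of_mul_le_mul_left ?_ hK
        rw [h7, h9] at h8
        linarith
      have h11 : full t (cons d e) =
          (1 - t) ^ (deg (cons d e) - 1) * ((1 - t) ^ inner (cons d e) - t) := by
        rw [h6]
        refine mul_left_cancel₀ (sub_pos.2 hs').ne' ?_
        rw [h7, mul_left_comm, star_merge, h10, h9]
        ring
      have hone := hr (by simp) hg h4 h11
      have hpow : ∀ m, 1 - (1 - t) ^ m = 0 → m = 0 := fun m hm => by
        by_contra hm0
        have := pow_lt_one₀ hy0.le (by linarith) hm0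
        linarith
      rcases mul_eq_zero.1 h10 with h12 | h12
      · have h13 := hpow _ ((mul_eq_zero.1 h12).resolve_left ht.ne')
        rw [inner, h13, zero_add, eq_nil_of_size h13]
        exact OneLong.there hone
      · have h13 := hpow _ h12
        rw [inner, h13, add_zero, ← hc, eq_nils_of_inner h13]
        exact OneLong.here _

/-- The comparison with the double star, with its equality case. -/
lemma lower_bound (ht : 0 < t) (ht1 : t < 1) {f : PlaneForest} (hf : f ≠ nil)
    (h : 0 < tree t (cons (nils (inner f)) (nils (deg f - 1)))) :
    tree t (cons (nils (inner f)) (nils (deg f - 1))) ≤ tree t f ∧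
      (tree t f = tree t (cons (nils (inner f)) (nils (deg f - 1))) →
        OneLong (nils (inner f)) f) := by
  have hy0 : 0 < 1 - t := by linarith
  simp only [tree, full_cons, low_cons, full_nils, low_nils, mul_one] at h ⊢
  -- Positivity of the double star is what supplies the hypothesis of `lower_vals`.
  have hin : t < (1 - t) ^ inner f := by
    have h1 : 0 < t * (1 - t) ^ inner f := by positivity
    have h2 : 0 < ((1 - t) ^ inner f - t) * (1 - t) ^ (deg f - 1) := by linarith
    exact sub_pos.1 ((mul_pos_iff_of_pos_right (by positivity)).1 h2)
  obtain ⟨h1, h2, h3, h4⟩ := lower_vals ht ht1 f hin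
  have h5 := h4 hf
  have h6 := mul_le_mul_of_nonneg_left h3 ht.le
  refine ⟨by linarith, fun heq => oneLong_nils_of_eq ht ht1 f hf hin ?_ (by linarith)⟩
  exact le_antisymm h3 (le_of_mul_le_mul_left (by linarith) ht)

end PlaneForest

namespace PlaneForest
variable {t : ℝ}

/-! ### Paths -/

@[simp] lemma full_path_succ (m : ℕ) :
    full t (path (m + 1)) = full t (path m) - t * low t (path m) := by
  simp [path]

@[simp] lemma low_path_succ (m : ℕ) : low t (path (m + 1)) = full t (path m) := by
  simp [path]

/-- The third identity deletes a vertex with paths of `m` and `n` vertices on its sides. The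
convention `low t (path 0) = 1` keeps all three valid for empty paths, and the factor `t` in the
second avoids division. -/
lemma path_add (m n : ℕ) :
    full t (path (m + n)) = full t (path m) * full t (path n) -
        (low t (path m) - full t (path m)) * (low t (path n) - full t (path n)) ∧
      t * low t (path (m + n)) = t * (low t (path m) * low t (path n)) -
        (low t (path m) - full t (path m)) * (low t (path n) - full t (path n)) ∧
      full t (path (m + 1 + n)) =
        full t (path m) * full t (path n) - t * (low t (path m) * low t (path n)) := by
  have key : ∀ m, full t (path (m + n)) = full t (path m) * full t (path n) -
        (low t (path m) - full t (path m)) * (low t (path n) - full t (path n)) →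
      t * low t (path (m + n)) = t * (low t (path m) * low t (path n)) -
        (low t (path m) - full t (path m)) * (low t (path n) - full t (path n)) →
      full t (path (m + 1 + n)) =
        full t (path m) * full t (path n) - t * (low t (path m) * low t (path n)) := by
    intro m h1 h2
    rw [add_right_comm, full_path_succ, h1, h2]; ring
  induction m with
  | zero =>
    have h1 : full t (path 0) = 1 := rfl
    have h2 : low t (path 0) = 1 := rfl
    refine ⟨by simp [h1, h2], by simp [h1, h2], key 0 ?_ ?_⟩ <;> simp [h1, h2]
  | succ m ih =>
    obtain ⟨h1, h2, h3⟩ := ih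
    have h4 : full t (path (m + 1 + n)) = full t (path (m + 1)) * full t (path n) -
        (low t (path (m + 1)) - full t (path (m + 1))) * (low t (path n) - full t (path n)) := by
      rw [h3, full_path_succ, low_path_succ]; ring
    have h5 : t * low t (path (m + 1 + n)) = t * (low t (path (m + 1)) * low t (path n)) -
        (low t (path (m + 1)) - full t (path (m + 1))) * (low t (path n) - full t (path n)) := by
      rw [add_right_comm, low_path_succ, h1, full_path_succ, low_path_succ]; ring
    exact ⟨h4, h5, key _ h4 h5⟩

/-- The defect `D` governing the replacement of two paths by a single one. -/
noncomputable def defect (t : ℝ) (m n : ℕ) : ℝ :=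
  (low t (path m) - full t (path m)) * (low t (path n) - full t (path n))

/-- Compares the ratio `full / low` of two paths side by side with that of one path of the same
total order. -/
lemma path_ratio (m n : ℕ) :
    t * (low t (path m) * low t (path n) * full t (path (m + n)) -
      full t (path m) * full t (path n) * low t (path (m + n))) =
    defect t m n * full t (path (m + 1 + n)) := by
  obtain ⟨h1, h2, h3⟩ := path_add (t := t) m n
  rw [defect, h3]
  linear_combination t * (low t (path m) * low t (path n)) * h1 -
    full t (path m) * full t (path n) * h2

lemma path_merge (m n : ℕ) :
    full t (path (m + 1)) * full t (path (n + 1)) =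
      (1 - t) * full t (path (m + n + 1)) + t * defect t m n := by
  have h := (path_add (t := t) m n).2.2
  rw [defect, add_right_comm m n 1, h, full_path_succ, full_path_succ]
  ring

lemma defect_eq (m n : ℕ) :
    full t (path m) * full t (path n) = full t (path (m + n)) + defect t m n := by
  rw [(path_add m n).1, defect]; ring

lemma pos_path {m : ℕ} : Pos t (path m) ↔ ∀ i ≤ m, 0 < full t (path i) := by
  induction m with
  | zero => simp [path, Pos]
  | succ m ih =>
    constructor
    · intro h i hi
      rcases Nat.le_succ_iff.1 hi with h1 | rfl
      · exact ih.1 h.2.1 i h1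
      · exact h.full_pos
    · intro h
      refine ⟨?_, ih.2 fun i hi => h i (by omega), trivial⟩
      have := h (m + 1) le_rfl
      rwa [full_path_succ] at this

lemma pos_path_of_le {m n : ℕ} (h : Pos t (path n)) (hmn : m ≤ n) : Pos t (path m) :=
  pos_path.2 fun i hi => pos_path.1 h i (hi.trans hmn)

lemma defect_nonneg (ht : 0 ≤ t) {m n : ℕ} (hm : Pos t (path m)) (hn : Pos t (path n)) :
    0 ≤ defect t m n :=
  mul_nonneg (sub_nonneg.2 (hm.full_le_low ht)) (sub_nonneg.2 (hn.full_le_low ht))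

lemma defect_eq_zero (ht : 0 < t) {m n : ℕ} (hm : Pos t (path m)) (hn : Pos t (path n))
    (h : defect t m n = 0) : m = 0 ∨ n = 0 := by
  have key : ∀ j, Pos t (path j) → low t (path j) - full t (path j) = 0 → j = 0 := by
    intro j hj h0
    have := full_eq_of_low ht hj (by linarith)
    rw [← size_path j, this, size]
  rcases mul_eq_zero.1 h with h | h
  · exact Or.inl (key _ hm h)
  · exact Or.inr (key _ hn h)

lemma path_ratio_succ (ht : 0 ≤ t) (n : ℕ) :
    full t (path (n + 1)) * low t (path n) ≤ full t (path n) * low t (path (n + 1)) := by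
  induction n with
  | zero => simpa [path] using ht
  | succ n ih =>
    have := mul_le_mul_of_nonneg_left ih ht
    simp only [full_path_succ, low_path_succ] at this ⊢
    linarith

lemma path_ratio_anti (ht : 0 ≤ t) {m n : ℕ} (hmn : m ≤ n) (h : Pos t (path n)) :
    full t (path n) * low t (path m) ≤ full t (path m) * low t (path n) := by
  induction n, hmn using Nat.le_induction with
  | base => exact le_rfl
  | succ n hmn ih =>
    have hn := pos_path_of_le h n.le_succ
    have hm := pos_path_of_le hn hmn
    have h1 := path_ratio_succ ht n
    have h2 := ih hn
    rw [← div_le_div_iff₀ hn.low_pos hm.low_pos] at h2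
    rw [← div_le_div_iff₀ h.low_pos hn.low_pos] at h1
    rw [← div_le_div_iff₀ h.low_pos hm.low_pos]
    exact h1.trans h2

/-- By vertex deletion, positivity of the path on `m + 1 + j` vertices is a lower bound on `full /
low` for `path j`. This ratio decreases in `j`, so the case `j = n` implies the others. -/
lemma pos_path_join (ht : 0 ≤ t) {m n : ℕ} (hm : Pos t (path m)) (hn : Pos t (path n))
    (h : 0 < full t (path (m + 1 + n))) : Pos t (path (m + 1 + n)) := by
  rw [pos_path]
  intro i hi
  rcases le_or_gt i m with h1 | h1
  · exact pos_path.1 hm i h1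
  · obtain ⟨j, rfl⟩ : ∃ j, i = m + 1 + j := ⟨i - (m + 1), by omega⟩
    have hj := pos_path_of_le hn (m := j) (by omega)
    have h2 := path_ratio_anti ht (m := j) (by omega) hn
    rw [(path_add m n).2.2] at h
    rw [(path_add m j).2.2]
    have h3 := mul_le_mul_of_nonneg_left h2 hm.full_pos.le
    have h4 := mul_pos h hj.low_pos
    refine (mul_pos_iff_of_pos_right hn.low_pos).1 ?_
    linarith

/-! ### Replacing a forest by a path -/

/-- If `p - w q` is at most `p' - w q'` for `w = t` and `p / q ≤ p' / q'`, then the former holds for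
all `w` between `t` and `p / q`; here `w` is replaced by a quotient `w / u`. -/
lemma interpolate {p q p' q' u w : ℝ} (h1 : p - t * q ≤ p' - t * q') (h2 : p * q' ≤ p' * q)
    (hq : 0 < q) (hu : 0 < u) (hw : t * u ≤ w) (hpos : w * q ≤ u * p) :
    u * p - w * q ≤ u * p' - w * q' := by
  obtain ⟨s, hs, rfl⟩ : ∃ s, 0 ≤ s ∧ w = t * u + s := ⟨w - t * u, by linarith, by ring⟩
  have h3 : 0 ≤ u * ((p' - t * q') - (p - t * q)) := mul_nonneg hu.le (sub_nonneg.2 h1)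
  rcases le_total q' q with h | h
  · nlinarith [mul_nonneg hs (sub_nonneg.2 h)]
  · have h4 : s * q ≤ u * (p - t * q) := by linarith
    have h5 := mul_le_mul_of_nonneg_right h4 (sub_nonneg.2 h)
    have h6 := mul_nonneg hu.le (sub_nonneg.2 h2)
    have h7 : 0 ≤ q * ((u * p' - (t * u + s) * q') - (u * p - (t * u + s) * q)) := by
      nlinarith
    linarith [nonneg_of_mul_nonneg_right h7 hq]

/-- Away from the end `w = t * u`, an affine function that is nonnegative at both ends of the
interval can vanish only if it vanishes at the end `w / u = p / q`. -/
lemma interpolate_eq {p q p' q' u w : ℝ} (h1 : p - t * q ≤ p' - t * q') (h2 : p * q' ≤ p' * q)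
    (hq : 0 < q) (hu : 0 < u) (hw : t * u < w) (hpos : w * q ≤ u * p)
    (heq : u * p - w * q = u * p' - w * q') : p * q' = p' * q := by
  refine le_antisymm h2 (not_lt.1 fun h3 => ?_)
  obtain ⟨s, hs, rfl⟩ : ∃ s, 0 < s ∧ w = t * u + s := ⟨w - t * u, by linarith, by ring⟩
  have h0 : 0 ≤ u * ((p' - t * q') - (p - t * q)) := mul_nonneg hu.le (sub_nonneg.2 h1)
  rcases le_or_gt q' q with h | h
  · rcases h.lt_or_eq with h | rfl
    · nlinarith [mul_pos hs (sub_pos.2 h)]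
    · have h4 : p < p' := lt_of_mul_lt_mul_right h3 hq.le
      nlinarith [mul_pos hu (sub_pos.2 h4)]
  · have h4 : s * q ≤ u * (p - t * q) := by linarith
    have h5 := mul_le_mul_of_nonneg_right h4 (sub_nonneg.2 h.le)
    have h6 := mul_pos hu (sub_pos.2 h3)
    have h7 : 0 < q * ((u * p' - (t * u + s) * q') - (u * p - (t * u + s) * q)) := by
      nlinarith
    rw [heq, sub_self, mul_zero] at h7
    exact lt_irrefl _ h7

lemma good_of_good_cons (ht : 0 < t) {c r : PlaneForest} (h : Pos t (cons (cons c r) nil)) :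
    Pos t (cons c nil) ∧ Pos t (cons r nil) ∧ t * full t c < tree t c := by
  obtain ⟨h1, ⟨hc1, hc2, hr⟩, -⟩ := h
  have h1' : 0 < tree t c * full t r - t * (full t c * low t r) := h1
  have hle : tree t c ≤ full t c := sub_le_self _ (mul_pos ht hc2.low_pos).le
  have h2 := mul_le_mul_of_nonneg_right hle hr.full_pos.le
  have h3 := mul_le_mul_of_nonneg_left (hr.full_le_low ht.le) (mul_pos ht hc2.full_pos).le
  refine ⟨⟨hc1, hc2, trivial⟩, ⟨?_, hr, trivial⟩, ?_⟩
  · have : 0 < full t c * (full t r - t * low t r) := by linarith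
    exact (mul_pos_iff_of_pos_left hc2.full_pos).1 this
  · have : 0 < (tree t c - t * full t c) * full t r := by linarith
    exact sub_pos.1 ((mul_pos_iff_of_pos_right hr.full_pos).1 this)

/-- The value and the ratio are proved together, since the induction for the value uses
`interpolate`, which needs both. Only the ratio has a rigid equality case: the value does not see
where a path is rooted. -/
lemma path_compare (ht : 0 < t) (f : PlaneForest) (h : Pos t (cons f nil)) :
    Pos t (path (size f + 1)) ∧ tree t f ≤ tree t (path (size f)) ∧
      full t f * low t (path (size f)) ≤ full t (path (size f)) * low t f ∧
      (full t f * low t (path (size f)) = full t (path (size f)) * low t f →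
        f = path (size f)) := by
  induction f with
  | nil => exact ⟨h, le_rfl, le_rfl, fun _ => rfl⟩
  | cons c r hc hr =>
    obtain ⟨gc, gr, hpq⟩ := good_of_good_cons ht h
    obtain ⟨c0, c1, c2, c3⟩ := hc gc
    obtain ⟨r0, r1, r2, r3⟩ := hr gr
    set M := size c with hM
    set N := size r with hN
    have hposc : Pos t c := gc.2.1
    have hposr : Pos t r := gr.2.1
    have hposM : Pos t (path M) := pos_path_of_le c0 (by omega)
    have hposN : Pos t (path N) := pos_path_of_le r0 (by omega)
    have ht1 : t < 1 := by
      have h1 : 0 < tree t c := gc.1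
      have h2 := tree_le_mul_full ht.le hposc
      have := (mul_pos_iff_of_pos_right hposc.full_pos).1 (h1.trans_le h2)
      linarith
    have b1 : tree t c - t * full t c ≤
        full t (path (M + 1)) - t * low t (path (M + 1)) := by
      -- These weights arise from `tree t c - t * full t c = (1 - t) * full t c - t * low t c`.
      have h3 := interpolate (u := 1 - t) (w := t) c1 c2 hposc.low_pos (by linarith)
        (by nlinarith [sq_nonneg t]) (by rw [tree] at hpq; linarith)
      rw [full_path_succ, low_path_succ, tree]
      linarith
    have b2 : tree t c * low t (path (M + 1)) ≤ full t (path (M + 1)) * full t c := by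
      rw [full_path_succ, low_path_succ, tree]
      nlinarith [mul_le_mul_of_nonneg_left c2 ht.le]
    have hfull : full t (cons c r) = tree t c * full t r := rfl
    have hlow : low t (cons c r) = full t c * low t r := rfl
    have htree : 0 < tree t c * full t r - t * (full t c * low t r) := h.1
    have htc : 0 < tree t c := gc.1
    have hle : tree t c ≤ full t c := sub_le_self _ (mul_pos ht hposc.low_pos).le
    -- First `r` is replaced by a path with `c` fixed, then `c` with the new path fixed. The result
    -- is a path rooted at the vertex between its two arms.
    have s1 := interpolate (u := tree t c) (w := t * full t c) r1 r2 hposr.low_pos htc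
      (mul_le_mul_of_nonneg_left hle ht.le) (by linarith)
    have hNpos := hposN.full_pos
    have s2 := interpolate (u := full t (path N)) (w := t * low t (path N)) b1 b2 hposc.full_pos
      hNpos (mul_le_mul_of_nonneg_left (hposN.full_le_low ht.le) ht.le) (by linarith)
    have hsz : size (cons c r) = M + 1 + N := rfl
    have j3 := (path_add (t := t) (M + 1) N).2.2
    have e1 : tree t (cons c r) ≤ tree t (path (M + 1 + N)) := by
      have : tree t (path (M + 1 + N)) = full t (path (M + 1 + 1 + N)) := by
        rw [add_right_comm (M + 1) 1 N, full_path_succ, tree]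
      rw [this, j3, tree, hfull, hlow]
      linarith
    have htreep : 0 < tree t (path (M + 1 + N)) := h.1.trans_le e1
    have hposM1 : Pos t (path (M + 1)) := c0
    have e0 : Pos t (path (M + 1 + N + 1)) := by
      rw [add_right_comm (M + 1) N 1]
      refine pos_path_join ht.le c0 hposN ?_
      rw [add_right_comm (M + 1) 1 N, full_path_succ]
      exact htreep
    have hposS : Pos t (path (M + 1 + N)) := pos_path_of_le e0 (by omega)
    rw [hsz, hfull, hlow]
    have hS : full t (path (M + 1 + 1 + N)) = tree t (path (M + 1 + N)) := by
      rw [add_right_comm (M + 1) 1 N, full_path_succ, tree]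
    have hratio := path_ratio (t := t) (M + 1) N
    rw [hS] at hratio
    have hD := defect_nonneg ht.le hposM1 hposN
    have hprod : 0 < low t (path (M + 1)) * low t (path N) :=
      mul_pos hposM1.low_pos hposN.low_pos
    have k1 : full t (path (M + 1)) * full t (path N) * low t (path (M + 1 + N)) ≤
        low t (path (M + 1)) * low t (path N) * full t (path (M + 1 + N)) := by
      have := mul_nonneg hD htreep.le
      rw [← hratio] at this
      linarith [nonneg_of_mul_nonneg_right this ht]
    have k2 : (tree t c * full t r) * (low t (path (M + 1)) * low t (path N)) ≤
        (full t (path (M + 1)) * full t (path N)) * (full t c * low t r) := by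
      have := mul_le_mul b2 r2 (mul_pos hposr.full_pos hposN.low_pos).le
        (mul_pos hposM1.full_pos hposc.full_pos).le
      linarith
    have hql : 0 < full t c * low t r := mul_pos hposc.full_pos hposr.low_pos
    have k3 := mul_le_mul_of_nonneg_right k2 hposS.low_pos.le
    have k4 := mul_le_mul_of_nonneg_right k1 hql.le
    refine ⟨e0, e1, le_of_mul_le_mul_left ?_ hprod, fun heq => ?_⟩
    · linarith
    · have heq' := congrArg (fun x => low t (path (M + 1)) * low t (path N) * x) heq
      have k5 : (low t (path (M + 1)) * low t (path N) * full t (path (M + 1 + N)) -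
          full t (path (M + 1)) * full t (path N) * low t (path (M + 1 + N))) *
            (full t c * low t r) = 0 := by linarith
      have k6 := (mul_eq_zero.1 k5).resolve_right hql.ne'
      rw [k6, mul_zero] at hratio
      have k7 := (mul_eq_zero.1 hratio.symm).resolve_right htreep.ne'
      have hN0 : N = 0 := (defect_eq_zero ht hposM1 hposN k7).resolve_left (by omega)
      have hrnil : r = nil := eq_nil_of_size hN0
      rw [hN0, hrnil] at heq
      simp only [full_nil, low_nil, mul_one, add_zero, full_path_succ, low_path_succ] at heq
      have k8 : full t c * low t (path M) = full t (path M) * low t c := by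
        rw [tree] at heq
        exact mul_left_cancel₀ ht.ne' (by linarith)
      rw [hN0, hrnil, add_zero, path, ← c3 k8]

/-! ### The upper bound -/

lemma lt_one_of_pos (ht : 0 < t) {f : PlaneForest} (h : Pos t (cons f nil)) : t < 1 := by
  have h1 : 0 < tree t f := h.1
  have h2 := tree_le_mul_full ht.le h.2.1
  have := (mul_pos_iff_of_pos_right h.2.1.full_pos).1 (h1.trans_le h2)
  linarith

lemma OneLong.eq_of_singleton {d c : PlaneForest} (h : OneLong d (cons c nil)) : c = d := by
  generalize hx : cons c nil = x at h
  cases h with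
  | here => injection hx
  | there h =>
    injection hx with _ h2
    subst h2
    cases h

/-- The comparison of a forest with the forest having one long path and isolated vertices, below a
vertex of weight `w / u`. -/
lemma long_compare (ht : 0 < t) (f : PlaneForest) (hf : f ≠ nil) {u w : ℝ} (hu : 0 < u)
    (hw : t * u ≤ w) (hpos : Pos t f) (hlt : w * low t f < u * full t f) :
    u * full t f - w * low t f ≤ u * ((1 - t) ^ (deg f - 1) * full t (path (inner f + 1))) -
        w * full t (path (inner f)) ∧
      ((t * u < w ∨ 2 ≤ deg f) → u * full t f - w * low t f =
        u * ((1 - t) ^ (deg f - 1) * full t (path (inner f + 1))) - w * full t (path (inner f)) →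
        OneLong (path (inner f)) f ∨
          w = t * u ∧ ∃ m n, f = cons (path m) (cons (path n) nil)) := by
  induction f generalizing u w with
  | nil => exact absurd rfl hf
  | cons c r _ hr =>
    obtain ⟨hc1, hc2, hr1⟩ := hpos
    have htc : 0 < full t c - t * low t c := hc1
    have hw0 : 0 < w := (mul_pos ht hu).trans_le hw
    have gc : Pos t (cons c nil) := ⟨hc1, hc2, trivial⟩
    have ht1 := lt_one_of_pos ht gc
    have hlt' : w * (full t c * low t r) < u * ((full t c - t * low t c) * full t r) := hlt
    have hcle : full t c - t * low t c ≤ full t c := sub_le_self _ (mul_pos ht hc2.low_pos).le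
    have hclt : full t c - t * low t c < full t c := sub_lt_self _ (mul_pos ht hc2.low_pos)
    have hq : w * full t c < u * (full t c - t * low t c) := by
      have h3 := mul_le_mul_of_nonneg_left (hr1.full_le_low ht.le) (mul_pos hw0 hc2.full_pos).le
      have : 0 < (u * (full t c - t * low t c) - w * full t c) * full t r := by linarith
      exact sub_pos.1 ((mul_pos_iff_of_pos_right hr1.full_pos).1 this)
    -- the tree with forest `c` below the root, as a forest, against the path
    have gcc : Pos t (cons (cons c nil) nil) := by
      refine ⟨?_, gc, trivial⟩
      have h1 := mul_le_mul_of_nonneg_right hw hc2.full_pos.le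
      have h2 : 0 < u * (full t c - t * low t c - t * full t c) := by linarith
      have h3 := (mul_pos_iff_of_pos_left hu).1 h2
      simpa [tree] using h3
    obtain ⟨p0, p1, p2, p3⟩ := path_compare ht (cons c nil) gcc
    have hsz : size (cons c nil) = size c + 1 := rfl
    rw [hsz] at p0 p1 p2 p3
    simp only [tree, full_cons, low_cons, full_nil, low_nil, mul_one] at p1 p2 p3
    set M := size c with hM
    have hposM : Pos t (path M) := pos_path_of_le p0 (by omega)
    have hposM1 : Pos t (path (M + 1)) := pos_path_of_le p0 (by omega)
    cases r with
    | nil =>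
      simp only [inner, deg, full_cons, low_cons, full_nil, low_nil, mul_one, ← hM, add_zero,
        zero_add, Nat.sub_self, pow_zero, one_mul]
      have h1 := interpolate p1 p2 hc2.full_pos hu hw hq.le
      rw [low_path_succ] at h1
      refine ⟨h1, fun hor heq => Or.inl ?_⟩
      have hs : t * u < w := hor.resolve_right (by omega)
      have h2 := p3 (interpolate_eq p1 p2 hc2.full_pos hu hs hq.le (by rw [low_path_succ]; exact heq))
      rw [path] at h2
      injection h2 with h2
      rw [← h2]
      exact OneLong.here 0
    | cons d e =>
      have hdeg : ∀ d e, deg (cons d e) - 1 = deg e := fun d e => by simp [deg]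
      have hinner : inner (cons c (cons d e)) = M + inner (cons d e) := rfl
      have hw' : t * (u * (full t c - t * low t c)) ≤ w * full t c := by
        have := mul_le_mul hw hcle htc.le hw0.le
        linarith
      have gr : Pos t (cons (cons d e) nil) := by
        refine ⟨?_, hr1, trivial⟩
        have h1 := mul_le_mul_of_nonneg_right hw' hr1.low_pos.le
        have h2 : 0 < u * (full t c - t * low t c) *
            (full t (cons d e) - t * low t (cons d e)) := by linarith
        exact (mul_pos_iff_of_pos_left (mul_pos hu htc)).1 h2
      have q0 : Pos t (path (inner (cons d e) + 1)) :=
        pos_path_of_le (path_compare ht _ gr).1 (by rw [size_eq]; omega)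
      -- The value of the first tree is absorbed into the weights, which is why the statement is
      -- proved for general `u` and `w`.
      obtain ⟨q1, q2⟩ := hr (by simp) (u := u * (full t c - t * low t c)) (w := w * full t c)
        (mul_pos hu htc)
        hw' hr1 (by linarith)
      rw [hdeg] at q1 q2
      set g := inner (cons d e) with hg
      set j := deg e with hj
      have hposg : Pos t (path g) := pos_path_of_le q0 (by omega)
      have hyj : 0 < (1 - t) ^ j := pow_pos (by linarith) j
      have hyj1 : (1 - t) ^ j ≤ 1 := pow_le_one₀ (by linarith) (by linarith)
      have hU : 0 < u * ((1 - t) ^ j * full t (path (g + 1))) :=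
        mul_pos hu (mul_pos hyj q0.full_pos)
      have hgg : full t (path (g + 1)) < full t (path g) := by
        rw [full_path_succ]; exact sub_lt_self _ (mul_pos ht hposg.low_pos)
      have hUW : t * (u * ((1 - t) ^ j * full t (path (g + 1)))) < w * full t (path g) := by
        have h1 : (1 - t) ^ j * full t (path (g + 1)) < full t (path g) :=
          (mul_le_of_le_one_left q0.full_pos.le hyj1).trans_lt hgg
        have h2 := mul_lt_mul_of_pos_left h1 (mul_pos ht hu)
        have h3 := mul_le_mul_of_nonneg_right hw hposg.full_pos.le
        linarith
      have hUWq : w * full t (path g) * full t c ≤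
          u * ((1 - t) ^ j * full t (path (g + 1))) * (full t c - t * low t c) := by linarith
      have s1 := interpolate p1 p2 hc2.full_pos hU hUW.le hUWq
      have hm := path_merge (t := t) g M
      have hd := defect_eq (t := t) g M
      have hD := defect_nonneg ht.le hposg hposM
      have hwj : 0 ≤ w - t * (u * (1 - t) ^ j) := by
        have := mul_le_mul_of_nonneg_left hyj1 (mul_pos ht hu).le
        linarith
      have hDw := mul_nonneg hD hwj
      rw [low_path_succ] at s1
      -- Merging the arms with `g + 1` and `M + 1` vertices yields an arm with `g + M + 1` vertices
      -- and an isolated vertex; the subtracted term is the loss.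
      have s2 : u * ((1 - t) ^ j * full t (path (g + 1))) * full t (path (M + 1)) -
          w * full t (path g) * full t (path M) =
          u * ((1 - t) ^ (j + 1) * full t (path (g + M + 1))) - w * full t (path (g + M)) -
            defect t g M * (w - t * (u * (1 - t) ^ j)) := by
        rw [pow_succ]
        linear_combination u * (1 - t) ^ j * hm - w * hd
      have hdeg2 : deg (cons d e) = j + 1 := rfl
      rw [hdeg, hinner, hdeg2, add_comm M g]
      have hfull : full t (cons c (cons d e)) =
          (full t c - t * low t c) * full t (cons d e) := rfl
      have hlow : low t (cons c (cons d e)) = full t c * low t (cons d e) := rfl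
      rw [hfull, hlow]
      refine ⟨by linarith, fun hor heq => ?_⟩
      have hw'' : t * (u * (full t c - t * low t c)) < w * full t c := by
        have h1 := mul_lt_mul_of_pos_left hclt hw0
        have h2 := mul_le_mul_of_nonneg_right hw htc.le
        linarith
      -- The new weights are strictly above `t` because `tree t c < full t c`, so the exceptional
      -- case cannot occur for the remaining trees.
      have t1 := (q2 (Or.inl hw'') (by linarith)).resolve_right (fun h => hw''.ne' h.1)
      have t2 := p3 (interpolate_eq p1 p2 hc2.full_pos hU hUW hUWq
        (by rw [low_path_succ]; linarith))
      rw [path] at t2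
      injection t2 with t2
      have t3 : defect t g M * (w - t * (u * (1 - t) ^ j)) = 0 := by linarith
      rcases mul_eq_zero.1 t3 with h | h
      · left
        rcases defect_eq_zero ht hposg hposM h with h0 | h0
        · rw [h0] at t1
          rw [h0, zero_add, OneLong.eq_nils t1, ← t2]
          exact OneLong.here _
        · rw [h0] at t2
          rw [h0, add_zero, t2]
          exact OneLong.there t1
      · right
        have hj0 : j = 0 := by
          by_contra hj0
          have h1 := mul_lt_mul_of_pos_left (pow_lt_one₀ (by linarith) (by linarith) hj0 :
            (1 - t) ^ j < 1) (mul_pos ht hu)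
          linarith
        have he : e = nil := by
          cases e with
          | nil => rfl
          | cons _ _ => exact absurd hj0 (by simp [hj, deg])
        rw [hj0, pow_zero] at h
        refine ⟨by linarith, M, g, ?_⟩
        rw [he] at t1
        rw [t2, he, t1.eq_of_singleton]

/-- The comparison with the tree having one long arm, with its equality case. -/
lemma upper_bound (ht : 0 < t) {f : PlaneForest} (hf : f ≠ nil) (h : Pos t (cons f nil)) :
    tree t f ≤ tree t (cons (path (inner f)) (nils (deg f - 1))) ∧
      (2 ≤ deg f → tree t f = tree t (cons (path (inner f)) (nils (deg f - 1))) →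
        OneLong (path (inner f)) f ∨ ∃ m n, f = cons (path m) (cons (path n) nil)) := by
  obtain ⟨h1, h2⟩ := long_compare ht f hf (u := 1) (w := t) one_pos (by simp) h.2.1
    (by have : 0 < full t f - t * low t f := h.1
        linarith)
  have h3 : tree t (cons (path (inner f)) (nils (deg f - 1))) =
      1 * ((1 - t) ^ (deg f - 1) * full t (path (inner f + 1))) - t * full t (path (inner f)) := by
    simp [tree]; ring
  have h4 : tree t f = 1 * full t f - t * low t f := by rw [tree, one_mul]
  rw [h3, h4]
  exact ⟨h1, fun hd heq => (h2 (Or.inr hd) heq).imp id fun h => h.2⟩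

end PlaneForest

/-! ### Graphs realizing a plane forest -/

namespace SimpleGraph

open PlaneForest

/-- The graph induced by `G` on `S` is a tree; rooted at `v`, it has the plane forest below the
root. -/
inductive Realizes {V : Type*} [DecidableEq V] (G : SimpleGraph V) :
    PlaneForest → V → Finset V → Prop
  | nil (v : V) : Realizes G nil v {v}
  | cons {c r : PlaneForest} {v u : V} {A B : Finset V} :
      Realizes G r v A → Realizes G c u B → Disjoint A B →
      (∀ x ∈ A, ∀ y ∈ B, G.Adj x y ↔ x = v ∧ y = u) → Realizes G (cons c r) v (A ∪ B)

variable {V W : Type*} [DecidableEq V] [DecidableEq W] {G : SimpleGraph V} {H : SimpleGraph W}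
  {f : PlaneForest} {v : V} {S : Finset V}

namespace Realizes

lemma root_mem (h : Realizes G f v S) : v ∈ S := by
  induction h with
  | nil v => simp
  | cons _ _ _ _ ih _ => exact Finset.mem_union_left _ ih

lemma card (h : Realizes G f v S) : S.card = size f + 1 := by
  induction h with
  | nil v => simp [size]
  | cons _ _ hd _ ih1 ih2 => rw [Finset.card_union_of_disjoint hd, ih1, ih2, size]; omega

lemma card_neighbors (h : Realizes G f v S) [DecidableRel G.Adj] :
    (S.filter (G.Adj v)).card = deg f := by
  induction h with
  | nil v => simp [deg, Finset.filter_singleton]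
  | @cons c r v u A B h1 h2 hd hadj ih1 ih2 =>
    have : B.filter (G.Adj v) = {u} := by
      ext y
      simp only [Finset.mem_filter, Finset.mem_singleton]
      constructor
      · rintro ⟨hy, hvy⟩
        exact ((hadj v h1.root_mem y hy).1 hvy).2
      · rintro rfl
        exact ⟨h2.root_mem, (hadj v h1.root_mem y h2.root_mem).2 ⟨rfl, rfl⟩⟩
    rw [Finset.filter_union, Finset.card_union_of_disjoint
      (hd.mono (Finset.filter_subset _ _) (Finset.filter_subset _ _)), ih1, this, deg]
    simp

lemma degree [Fintype V] [DecidableRel G.Adj] (h : Realizes G f v Finset.univ) :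
    G.degree v = deg f := by
  rw [← h.card_neighbors, ← G.card_neighborFinset_eq_degree]
  congr 1
  ext y
  simp

/-- `cons c r` treats the two ends of its edge symmetrically, so exchanging `c` and `r` moves the
root along it. -/
lemma reroot {c r : PlaneForest} (h : Realizes G (PlaneForest.cons c r) v S) :
    ∃ u, Realizes G (PlaneForest.cons r c) u S := by
  cases h with
  | @cons _ _ _ u A B h1 h2 hd hadj =>
    refine ⟨u, ?_⟩
    rw [Finset.union_comm]
    exact .cons h2 h1 hd.symm fun x hx y hy => by
      rw [G.adj_comm, hadj y hy x hx, and_comm]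

lemma swap {c d r : PlaneForest} (h : Realizes G (PlaneForest.cons c (PlaneForest.cons d r)) v S) :
    Realizes G (PlaneForest.cons d (PlaneForest.cons c r)) v S := by
  cases h with
  | @cons _ _ _ u _ B h1 h2 hd hadj =>
    cases h1 with
    | @cons _ _ _ u' A B' h3 h4 hd' hadj' =>
      rw [Finset.union_right_comm]
      rw [Finset.disjoint_union_left] at hd
      have hvA := h3.root_mem
      refine .cons (.cons h3 h2 hd.1 fun x hx y hy => hadj x (Finset.mem_union_left _ hx) y hy) h4
        (Finset.disjoint_union_left.2 ⟨hd', hd.2.symm⟩) fun x hx y hy => ?_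
      rcases Finset.mem_union.1 hx with hx | hx
      · exact hadj' x hx y hy
      · have h5 : y ≠ v := fun hyv => Finset.disjoint_left.1 hd' hvA (hyv ▸ hy)
        have h6 : x ≠ v := fun hxv => Finset.disjoint_left.1 hd.1 hvA (hxv ▸ hx)
        rw [G.adj_comm, hadj y (Finset.mem_union_right _ hy) x hx]
        simp [h5, h6]

lemma cons_congr {c r r' : PlaneForest} (h : Realizes G (PlaneForest.cons c r) v S)
    (hr : ∀ A, Realizes G r v A → Realizes G r' v A) :
    Realizes G (PlaneForest.cons c r') v S := by
  cases h with
  | cons h1 h2 hd hadj => exact .cons (hr _ h1) h2 hd hadj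

lemma of_oneLong {d : PlaneForest} (hf : OneLong d f) (h : Realizes G f v S) :
    Realizes G (PlaneForest.cons d (nils (deg f - 1))) v S := by
  induction hf generalizing S with
  | here j =>
    simpa [deg] using h
  | @there r hr ih =>
    have h1 := (h.cons_congr fun A hA => ih hA).swap
    have h2 : deg r - 1 + 1 = deg r := by
      cases hr <;> simp [deg]
    change Realizes G (PlaneForest.cons d (nils (deg r - 1 + 1))) v S at h1
    rwa [h2] at h1

/-- Each rerooting moves the root one step along the first arm, until it is next to an end. -/
lemma two_paths (m n : ℕ) (h : Realizes G (PlaneForest.cons (path m)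
    (PlaneForest.cons (path n) PlaneForest.nil)) v S) :
    ∃ u, Realizes G (PlaneForest.cons (path (m + n)) (nils 1)) u S := by
  induction m generalizing n v with
  | zero => exact ⟨v, by simpa [path, nils] using h.swap⟩
  | succ m ih =>
    obtain ⟨u, hu⟩ := h.reroot
    have h1 : Realizes G (PlaneForest.cons (path (n + 1)) (PlaneForest.cons (path m) .nil)) u S := hu
    obtain ⟨w, hw⟩ := ih (n + 1) h1.swap
    exact ⟨w, by rwa [Nat.add_right_comm, ← Nat.add_assoc] at *⟩

/-! #### Existence -/

lemma add_leaf (h : Realizes G f v S) {w z : V} (hw : w ∈ S) (hz : z ∉ S)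
    (hadj : ∀ x ∈ S, G.Adj x z ↔ x = w) : ∃ f', Realizes G f' v (insert z S) := by
  induction h with
  | nil v =>
    rw [Finset.mem_singleton] at hw
    subst hw
    refine ⟨PlaneForest.cons .nil .nil, ?_⟩
    rw [Finset.insert_eq, Finset.union_comm]
    exact .cons (.nil w) (.nil z) (Finset.disjoint_singleton_left.2 (by simpa [eq_comm] using hz))
      fun x hx y hy => by
        rw [Finset.mem_singleton] at hx hy
        subst hx hy
        simpa using hadj x (by simp)
  | @cons c r v u A B h1 h2 hd hab ih1 ih2 =>
    rw [Finset.mem_union, not_or] at hz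
    have hA : ∀ x ∈ A, G.Adj x z ↔ x = w := fun x hx => hadj x (Finset.mem_union_left _ hx)
    have hB : ∀ x ∈ B, G.Adj x z ↔ x = w := fun x hx => hadj x (Finset.mem_union_right _ hx)
    rcases Finset.mem_union.1 hw with hw | hw
    · obtain ⟨f', hf'⟩ := ih1 hw hz.1 hA
      refine ⟨PlaneForest.cons c f', ?_⟩
      rw [← Finset.insert_union]
      refine .cons hf' h2 (Finset.disjoint_insert_left.2 ⟨hz.2, hd⟩) fun x hx y hy => ?_
      rcases Finset.mem_insert.1 hx with rfl | hx
      · have h3 : y ≠ w := fun h => Finset.disjoint_left.1 hd hw (h ▸ hy)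
        have h4 : x ≠ v := fun h => hz.1 (h ▸ h1.root_mem)
        rw [G.adj_comm, hB y hy]
        simp [h3, h4]
      · exact hab x hx y hy
    · obtain ⟨f', hf'⟩ := ih2 hw hz.2 hB
      refine ⟨PlaneForest.cons f' r, ?_⟩
      rw [← Finset.union_insert]
      refine .cons h1 hf' (Finset.disjoint_insert_right.2 ⟨hz.1, hd⟩) fun x hx y hy => ?_
      rcases Finset.mem_insert.1 hy with rfl | hy
      · have h3 : x ≠ w := fun h => Finset.disjoint_left.1 hd hx (h ▸ hw)
        have h4 : y ≠ u := fun h => hz.2 (h ▸ h2.root_mem)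
        rw [hA x hx]
        simp [h3, h4]
      · exact hab x hx y hy

lemma exists_walk (h : Realizes G f v S) {x : V} (hx : x ∈ S) :
    ∃ p : G.Walk v x, ∀ y ∈ p.support, y ∈ S := by
  induction h generalizing x with
  | nil v =>
    rw [Finset.mem_singleton] at hx
    subst hx
    exact ⟨.nil, by simp⟩
  | @cons c r v u A B h1 h2 hd hab ih1 ih2 =>
    rcases Finset.mem_union.1 hx with hx | hx
    · obtain ⟨p, hp⟩ := ih1 hx
      exact ⟨p, fun y hy => Finset.mem_union_left _ (hp y hy)⟩
    · obtain ⟨p, hp⟩ := ih2 hx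
      refine ⟨.cons ((hab v h1.root_mem u h2.root_mem).2 ⟨rfl, rfl⟩) p, fun y hy => ?_⟩
      rw [Walk.support_cons, List.mem_cons] at hy
      rcases hy with rfl | hy
      · exact Finset.mem_union_left _ h1.root_mem
      · exact Finset.mem_union_right _ (hp y hy)

lemma eq_of_adj (h : Realizes G f v S) (hG : G.IsAcyclic) {w x z : V} (hw : w ∈ S) (hx : x ∈ S)
    (hz : z ∉ S) (hwz : G.Adj w z) (hxz : G.Adj x z) : x = w := by
  by_contra hne
  obtain ⟨p, hp⟩ := h.exists_walk hw
  obtain ⟨q, hq⟩ := h.exists_walk hx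
  have hs : z ∉ (p.reverse.append q).bypass.support := fun hmem => by
    have := Walk.support_bypass_subset_support _ hmem
    rw [Walk.mem_support_append_iff, Walk.support_reverse, List.mem_reverse] at this
    exact hz (this.elim (hp z) (hq z))
  -- Two neighbours of `z` in `S` would be joined both by a path inside `S` and by a path through
  -- `z`.
  have hpath : (Walk.cons hwz (Walk.cons hxz.symm Walk.nil)).IsPath := by
    simp [Walk.cons_isPath_iff, hwz.ne, Ne.symm hne, hxz.ne.symm]
  have h1 := (hG.subsingleton_path w x).elim ⟨_, (p.reverse.append q).bypass_isPath⟩ ⟨_, hpath⟩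
  rw [Subtype.mk.injEq] at h1
  rw [h1] at hs
  simp at hs

end Realizes

/-- The realized set grows by one vertex at a time: connectedness gives an edge leaving it, and
acyclicity makes the new vertex a leaf. -/
lemma IsTree.exists_realizes [Fintype V] (hG : G.IsTree) (v : V) :
    ∃ f, Realizes G f v Finset.univ := by
  have key : ∀ n, n < Fintype.card V → ∃ f S, Realizes G f v S ∧ S.card = n + 1 := by
    intro n
    induction n with
    | zero => exact fun _ => ⟨.nil, {v}, .nil v, by simp⟩
    | succ n ih =>
      intro hn
      obtain ⟨f, S, hS, hcard⟩ := ih (by omega)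
      obtain ⟨z, hz⟩ : ∃ z, z ∉ S := by
        by_contra! hall
        rw [Finset.eq_univ_iff_forall.2 hall, Finset.card_univ] at hcard
        omega
      obtain ⟨p⟩ := hG.1.preconnected v z
      obtain ⟨d, -, hd1, hd2⟩ := p.exists_boundary_dart (S : Set V) hS.root_mem hz
      obtain ⟨f', hf'⟩ := hS.add_leaf hd1 hd2 fun x hx =>
        ⟨fun hxz => hS.eq_of_adj hG.2 hd1 hx hd2 d.adj hxz, fun hxw => hxw ▸ d.adj⟩
      exact ⟨f', _, hf', by rw [Finset.card_insert_of_notMem hd2, hcard]⟩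
  have hpos : 0 < Fintype.card V := Fintype.card_pos_iff.2 ⟨v⟩
  obtain ⟨f, S, hS, hcard⟩ := key (Fintype.card V - 1) (by omega)
  have : S = Finset.univ := (Finset.card_eq_iff_eq_univ S).1 (by omega)
  exact ⟨f, this ▸ hS⟩

namespace Realizes

/-! #### Isomorphisms -/

lemma exists_bijOn [Nonempty W] {w : W} {S' : Finset W} (h : Realizes G f v S)
    (h' : Realizes H f w S') :
    ∃ φ : V → W, Set.BijOn φ S S' ∧ φ v = w ∧ ∀ x ∈ S, ∀ y ∈ S, H.Adj (φ x) (φ y) ↔ G.Adj x y := by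
  induction h generalizing w S' with
  | nil v =>
    cases h'
    exact ⟨fun _ => w, by simp, rfl, by simp⟩
  | @cons c r v u A B h1 h2 hd hab ih1 ih2 =>
    cases h' with
    | @cons _ _ _ u' A' B' h1' h2' hd' hab' =>
      obtain ⟨φ, hφ, hφv, hφa⟩ := ih1 h1'
      obtain ⟨ψ, hψ, hψu, hψa⟩ := ih2 h2'
      have eA : ∀ x ∈ A, (if x ∈ A then φ x else ψ x) = φ x := fun x hx => if_pos hx
      have eB : ∀ x ∈ B, (if x ∈ A then φ x else ψ x) = ψ x := fun x hx =>
        if_neg (Finset.disjoint_right.1 hd hx)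
      have hAB : ∀ x ∈ A, ∀ y ∈ B, H.Adj (φ x) (ψ y) ↔ G.Adj x y := fun x hx y hy => by
        rw [hab x hx y hy, hab' _ (hφ.mapsTo hx) _ (hψ.mapsTo hy), ← hφv, ← hψu,
          hφ.injOn.eq_iff hx h1.root_mem, hψ.injOn.eq_iff hy h2.root_mem]
      refine ⟨fun x => if x ∈ A then φ x else ψ x, ?_, (eA v h1.root_mem).trans hφv, ?_⟩
      · rw [Finset.coe_union, Finset.coe_union]
        refine Set.BijOn.union (hφ.congr fun x hx => (eA x hx).symm)
          (hψ.congr fun x hx => (eB x hx).symm) ?_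
        have hne : ∀ x ∈ A, ∀ y ∈ B, φ x ≠ ψ y := fun x hx y hy he =>
          Finset.disjoint_left.1 hd' (hφ.mapsTo hx) (he ▸ hψ.mapsTo hy)
        intro x hx y hy hxy
        rcases hx with hx | hx <;> rcases hy with hy | hy
        · simp only [eA x hx, eA y hy] at hxy
          exact hφ.injOn hx hy hxy
        · simp only [eA x hx, eB y hy] at hxy
          exact absurd hxy (hne x hx y hy)
        · simp only [eB x hx, eA y hy] at hxy
          exact absurd hxy.symm (hne y hy x hx)
        · simp only [eB x hx, eB y hy] at hxy
          exact hψ.injOn hx hy hxy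
      · intro x hx y hy
        rcases Finset.mem_union.1 hx with hx | hx <;> rcases Finset.mem_union.1 hy with hy | hy
        · simp only [eA x hx, eA y hy]; exact hφa x hx y hy
        · simp only [eA x hx, eB y hy]; exact hAB x hx y hy
        · simp only [eB x hx, eA y hy]
          rw [H.adj_comm, G.adj_comm]; exact hAB y hy x hx
        · simp only [eB x hx, eB y hy]; exact hψa x hx y hy

lemma nonempty_iso [Fintype V] [Fintype W] {w : W} (h : Realizes G f v Finset.univ)
    (h' : Realizes H f w Finset.univ) : Nonempty (G ≃g H) := by
  have : Nonempty W := ⟨w⟩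
  obtain ⟨φ, hφ, -, hadj⟩ := h.exists_bijOn h'
  rw [Finset.coe_univ, Finset.coe_univ, Set.bijOn_univ] at hφ
  exact ⟨⟨Equiv.ofBijective φ hφ, fun {x y} => hadj x (Finset.mem_univ _) y (Finset.mem_univ _)⟩⟩

lemma map_iso (e : G ≃g H) (h : Realizes G f v S) :
    Realizes H f (e v) (S.map e.toEquiv.toEmbedding) := by
  induction h with
  | nil v => exact .nil _
  | cons _ _ hd hab ih1 ih2 =>
    rw [Finset.map_union]
    refine .cons ih1 ih2 ((Finset.disjoint_map _).2 hd) ?_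
    intro x hx y hy
    obtain ⟨x', hx', rfl⟩ := Finset.mem_map.1 hx
    obtain ⟨y', hy', rfl⟩ := Finset.mem_map.1 hy
    change H.Adj (e x') (e y') ↔ e x' = e _ ∧ e y' = e _
    rw [e.map_adj_iff, e.injective.eq_iff, e.injective.eq_iff]
    exact hab x' hx' y' hy'

end Realizes

end SimpleGraph

/-! ### The independence polynomial of a realized forest -/

namespace SimpleGraph

open PlaneForest

open scoped Classical in
/-- The contribution of a set of vertices to the independence polynomial. -/
noncomputable def indepWeight {V : Type*} (G : SimpleGraph V) (x : ℝ) (X : Finset V) : ℝ :=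
  if G.IsIndepSet X then x ^ X.card else 0

lemma eval_indepPoly {V : Type*} [Fintype V] (G : SimpleGraph V) (x : ℝ) :
    (indepPoly G).eval x = ∑ X : Finset V, G.indepWeight x X := by
  classical
  have h := Finset.sum_fiberwise_of_maps_to (s := Finset.univ.filter fun X : Finset V => G.IsIndepSet X)
    (t := Finset.range (G.indepNum + 1)) (g := Finset.card) (fun X hX => by
      rw [Finset.mem_range, Nat.lt_succ_iff]
      exact IsIndepSet.card_le_indepNum (Finset.mem_filter.1 hX).2) (fun X => x ^ X.card)
  simp only [indepWeight]
  rw [← Finset.sum_filter, ← h, indepPoly, Polynomial.eval_finsetSum]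
  refine Finset.sum_congr rfl fun k _ => ?_
  rw [Finset.sum_congr rfl (g := fun _ => x ^ k)
    (fun X hX => by rw [(Finset.mem_filter.1 hX).2]), Finset.sum_const, nsmul_eq_mul,
    Polynomial.eval_mul, Polynomial.eval_C, Polynomial.eval_pow, Polynomial.eval_X]
  congr 2
  rw [← Set.ncard_coe_finset]
  congr 1
  ext X
  simp [isNIndepSet_iff]

variable {V : Type*} [DecidableEq V] {G : SimpleGraph V}

lemma sum_powerset_union {A B : Finset V} (hd : Disjoint A B) (F : Finset V → ℝ) :
    ∑ X ∈ (A ∪ B).powerset, F X = ∑ X ∈ A.powerset, ∑ Y ∈ B.powerset, F (X ∪ Y) := by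
  rw [← Finset.sum_product']
  refine Finset.sum_bij' (fun X _ => (X ∩ A, X ∩ B)) (fun p _ => p.1 ∪ p.2) ?_ ?_ ?_ ?_ ?_
  · intro X _
    simp [Finset.inter_subset_right]
  · intro p hp
    simp only [Finset.mem_product, Finset.mem_powerset] at hp ⊢
    exact Finset.union_subset_union hp.1 hp.2
  · intro X hX
    rw [← Finset.inter_union_distrib_left]
    exact Finset.inter_eq_left.2 (Finset.mem_powerset.1 hX)
  · rintro ⟨X, Y⟩ hp
    simp only [Finset.mem_product, Finset.mem_powerset] at hp
    simp only [Finset.union_inter_distrib_right, Finset.inter_eq_left.2 hp.1,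
      Finset.inter_eq_left.2 hp.2, Finset.disjoint_iff_inter_eq_empty.1 (hd.mono_left hp.1),
      Finset.disjoint_iff_inter_eq_empty.1 (hd.symm.mono_left hp.2), Finset.union_empty,
      Finset.empty_union]
  · intro X hX
    rw [← Finset.inter_union_distrib_left, Finset.inter_eq_left.2 (Finset.mem_powerset.1 hX)]

lemma indepWeight_union {A B X Y : Finset V} {v u : V} (hd : Disjoint A B)
    (hvA : v ∈ A) (huB : u ∈ B)
    (hab : ∀ x ∈ A, ∀ y ∈ B, G.Adj x y ↔ x = v ∧ y = u) (hX : X ⊆ A) (hY : Y ⊆ B) (x : ℝ) :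
    G.indepWeight x (X ∪ Y) =
      if v ∈ X ∧ u ∈ Y then 0 else G.indepWeight x X * G.indepWeight x Y := by
  have h1 : G.IsIndepSet ((X ∪ Y : Finset V) : Set V) ↔
      G.IsIndepSet X ∧ G.IsIndepSet Y ∧ ¬ (v ∈ X ∧ u ∈ Y) := by
    have hvu : v ≠ u := fun h => Finset.disjoint_left.1 hd hvA (h ▸ huB)
    constructor
    · intro h
      rw [Finset.coe_union] at h
      refine ⟨h.mono Set.subset_union_left, h.mono Set.subset_union_right, fun h2 => ?_⟩
      exact h (Or.inl h2.1) (Or.inr h2.2) hvu ((hab v hvA u huB).2 ⟨rfl, rfl⟩)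
    · rintro ⟨h2, h3, h4⟩ a ha b hb hne
      rw [Finset.coe_union] at ha hb
      rcases ha with ha | ha <;> rcases hb with hb | hb
      · exact h2 ha hb hne
      · rw [hab a (hX ha) b (hY hb)]
        rintro ⟨rfl, rfl⟩
        exact h4 ⟨ha, hb⟩
      · rw [G.adj_comm, hab b (hX hb) a (hY ha)]
        rintro ⟨rfl, rfl⟩
        exact h4 ⟨hb, ha⟩
      · exact h3 ha hb hne
  simp only [indepWeight, h1, Finset.card_union_of_disjoint (hd.mono hX hY), pow_add]
  split_ifs <;> simp_all

/-- Sorting by whether the root is chosen is what lets the induction pass through the new edge,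
which forbids only choosing both of its ends. -/
lemma Realizes.sum_indepWeight {f : PlaneForest} {v : V} {S : Finset V} (h : Realizes G f v S)
    (t : ℝ) :
    ∑ X ∈ S.powerset, (if v ∈ X then 0 else G.indepWeight (-t) X) = full t f ∧
      ∑ X ∈ S.powerset, (if v ∈ X then G.indepWeight (-t) X else 0) = -t * low t f := by
  induction h with
  | nil v =>
    have hp : ({v} : Finset V).powerset = {∅, {v}} := rfl
    rw [hp, Finset.sum_pair (Finset.singleton_ne_empty v).symm,
      Finset.sum_pair (Finset.singleton_ne_empty v).symm]
    simp [indepWeight]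
  | @cons c r v u A B h1 h2 hd hab ih1 ih2 =>
    have hvB : ∀ Y ∈ B.powerset, v ∉ Y := fun Y hY hv =>
      Finset.disjoint_left.1 hd h1.root_mem (Finset.mem_powerset.1 hY hv)
    have hB : ∑ Y ∈ B.powerset, G.indepWeight (-t) Y = full t c - t * low t c := by
      rw [sub_eq_add_neg, ← neg_mul, ← ih2.1, ← ih2.2, ← Finset.sum_add_distrib]
      refine Finset.sum_congr rfl fun Y _ => ?_
      split_ifs <;> simp
    rw [sum_powerset_union hd, sum_powerset_union hd, full_cons, low_cons]
    constructor
    · rw [← ih1.1, ← hB, mul_comm, Finset.sum_mul_sum]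
      refine Finset.sum_congr rfl fun X hX => Finset.sum_congr rfl fun Y hY => ?_
      rw [indepWeight_union hd h1.root_mem h2.root_mem hab (Finset.mem_powerset.1 hX)
        (Finset.mem_powerset.1 hY)]
      by_cases hv : v ∈ X <;> simp [hv, hvB Y hY]
    · rw [mul_left_comm, ← ih1.2, ← ih2.1, mul_comm, Finset.sum_mul_sum]
      refine Finset.sum_congr rfl fun X hX => Finset.sum_congr rfl fun Y hY => ?_
      rw [indepWeight_union hd h1.root_mem h2.root_mem hab (Finset.mem_powerset.1 hX)
        (Finset.mem_powerset.1 hY)]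
      by_cases hv : v ∈ X <;> by_cases hu : u ∈ Y <;> simp [hv, hu, hvB Y hY]

lemma Realizes.eval_indepPoly [Fintype V] {f : PlaneForest} {v : V}
    (h : Realizes G f v Finset.univ) (t : ℝ) : (indepPoly G).eval (-t) = tree t f := by
  obtain ⟨h1, h2⟩ := h.sum_indepWeight t
  rw [SimpleGraph.eval_indepPoly, tree, sub_eq_add_neg, ← neg_mul, ← h1, ← h2,
    ← Finset.sum_add_distrib, Finset.powerset_univ]
  refine Finset.sum_congr rfl fun Y _ => ?_
  split_ifs <;> simp

/-- The largest real root of the independence polynomial of a tree. -/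
lemma Realizes.exists_isLargestRoot [Fintype V] {f : PlaneForest} {v : V}
    (h : Realizes G f v Finset.univ) (hf : f ≠ .nil) :
    ∃ τ : ℝ, 0 < τ ∧ τ ≤ 1 / 2 ∧ IsLargestRoot G (-τ) ∧ ∀ t < τ, 0 < tree t f := by
  obtain ⟨s, hs, hle⟩ := exists_tree_nonpos hf
  have hroot : ∀ t, (indepPoly G).IsRoot (-t) ↔ tree t f = 0 := fun t => by
    rw [Polynomial.IsRoot, h.eval_indepPoly]
  have hcpt : IsCompact (Set.Icc (0 : ℝ) (1 / 2) ∩ {t | tree t f ≤ 0}) :=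
    isCompact_Icc.inter_right (isClosed_le (continuous_tree f) continuous_const)
  obtain ⟨τ, ⟨hτ, hτ0⟩, hmin⟩ := hcpt.exists_isLeast ⟨s, hs, hle⟩
  have hpos : ∀ t < τ, 0 < tree t f := by
    intro t ht
    rcases le_or_gt t 0 with h0 | h0
    · exact tree_pos_of_nonpos h0 f
    · by_contra hcon
      exact absurd ht (not_lt.2 (hmin ⟨⟨h0.le, ht.le.trans hτ.2⟩, not_lt.1 hcon⟩))
  have h0 : 0 < τ := by
    by_contra hcon
    exact absurd hτ0 (not_le.2 (tree_pos_of_nonpos (not_lt.1 hcon) f))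
  have h1 : 0 ≤ tree τ f :=
    nonneg_of_pos_Ico (continuous_tree f) h0 fun x hx => hpos x hx.2
  refine ⟨τ, h0, hτ.2, ⟨(hroot τ).2 (le_antisymm hτ0 h1), fun x hx => ?_⟩, hpos⟩
  by_contra hcon
  have h2 := hpos (-x) (by linarith)
  rw [Set.mem_ofPred_eq, ← neg_neg x, hroot] at hx
  exact h2.ne' hx

end SimpleGraph

/-! ### The extremal trees -/

namespace SimpleGraph

open PlaneForest

lemma realizes_nils {V : Type*} [DecidableEq V] {G : SimpleGraph V} {v : V} (L : Finset V)
    (hv : v ∉ L) (h1 : ∀ x ∈ L, G.Adj v x) (h2 : ∀ x ∈ L, ∀ y ∈ L, ¬ G.Adj x y) :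
    Realizes G (nils L.card) v (insert v L) := by
  induction L using Finset.induction_on with
  | empty => exact .nil v
  | insert z L hz ih =>
    rw [Finset.mem_insert, not_or] at hv
    have hr := ih hv.2 (fun x hx => h1 x (Finset.mem_insert_of_mem hx))
      fun x hx y hy => h2 x (Finset.mem_insert_of_mem hx) y (Finset.mem_insert_of_mem hy)
    have hu : insert v (insert z L) = insert v L ∪ {z} := by
      ext; simp
    rw [Finset.card_insert_of_notMem hz, hu]
    refine .cons hr (.nil z) ?_ ?_
    · rw [Finset.disjoint_singleton_right, Finset.mem_insert, not_or]
      exact ⟨Ne.symm hv.1, hz⟩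
    · intro x hx y hy
      rw [Finset.mem_singleton] at hy
      subst hy
      rcases Finset.mem_insert.1 hx with rfl | hx
      · simpa using h1 y (by simp)
      · have h3 : x ≠ v := fun h => hv.2 (h ▸ hx)
        simpa [h3] using h2 x (by simp [hx]) y (by simp)

lemma realizes_path {V : Type*} [DecidableEq V] {G : SimpleGraph V} (m : ℕ) (g : ℕ → V)
    (hinj : ∀ i ≤ m, ∀ j ≤ m, g i = g j → i = j)
    (hadj : ∀ i ≤ m, ∀ j ≤ m, G.Adj (g i) (g j) ↔ i + 1 = j ∨ j + 1 = i) :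
    Realizes G (path m) (g 0) ((Finset.range (m + 1)).image g) := by
  induction m generalizing g with
  | zero => exact .nil _
  | succ m ih =>
    have h1 := ih (fun i => g (i + 1))
      (fun i hi j hj h => by have := hinj (i + 1) (by omega) (j + 1) (by omega) h; omega)
      (fun i hi j hj => by rw [hadj (i + 1) (by omega) (j + 1) (by omega)]; omega)
    have hu : (Finset.range (m + 1 + 1)).image g =
        {g 0} ∪ (Finset.range (m + 1)).image (fun i => g (i + 1)) := by
      ext x
      simp only [Finset.mem_image, Finset.mem_range, Finset.mem_union, Finset.mem_singleton]
      constructor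
      · rintro ⟨i, hi, rfl⟩
        cases i with
        | zero => exact Or.inl rfl
        | succ i => exact Or.inr ⟨i, by omega, rfl⟩
      · rintro (rfl | ⟨i, hi, rfl⟩)
        · exact ⟨0, by omega, rfl⟩
        · exact ⟨i + 1, by omega, rfl⟩
    rw [hu, path]
    refine .cons (.nil _) h1 ?_ ?_
    · rw [Finset.disjoint_singleton_left, Finset.mem_image]
      rintro ⟨i, hi, h⟩
      rw [Finset.mem_range] at hi
      have := hinj (i + 1) (by omega) 0 (by omega) h
      omega
    · intro x hx y hy
      rw [Finset.mem_singleton] at hx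
      subst hx
      obtain ⟨i, hi, rfl⟩ := Finset.mem_image.1 hy
      rw [Finset.mem_range] at hi
      rw [hadj 0 (by omega) (i + 1) (by omega)]
      constructor
      · intro h
        have : i = 0 := by omega
        simp [this]
      · rintro ⟨-, h⟩
        have := hinj (i + 1) (by omega) (0 + 1) (by omega) h
        omega

lemma starlike_adj_none {k : ℕ} {m : Fin k → ℕ} (q : Σ i : Fin k, Fin (m i - 1)) :
    (starlike m).Adj none (some q) ↔ q.2.val = 0 := by
  simp [starlike, fromRel_adj]

lemma starlike_adj_some {k : ℕ} {m : Fin k → ℕ} (p q : Σ i : Fin k, Fin (m i - 1)) :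
    (starlike m).Adj (some p) (some q) ↔
      p.1 = q.1 ∧ (p.2.val + 1 = q.2.val ∨ q.2.val + 1 = p.2.val) := by
  simp only [starlike, fromRel_adj, ne_eq, Option.some.injEq]
  constructor
  · rintro ⟨-, ⟨h1, h2⟩ | ⟨h1, h2⟩⟩
    · exact ⟨h1, Or.inl h2⟩
    · exact ⟨h1.symm, Or.inr h2⟩
  · rintro ⟨h1, h2⟩
    refine ⟨?_, ?_⟩
    · rintro rfl
      omega
    · rcases h2 with h2 | h2
      · exact Or.inl ⟨h1, h2⟩
      · exact Or.inr ⟨h1.symm, h2⟩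

lemma realizes_starlike {K p : ℕ} {m : Fin (K + 1) → ℕ} (h0 : m 0 - 1 = p + 1)
    (h1 : ∀ i : Fin K, m i.succ - 1 = 1) :
    Realizes (starlike m) (PlaneForest.cons (path p) (nils K)) none Finset.univ := by
  classical
  let leaf : Fin K → Option (Σ i, Fin (m i - 1)) := fun i =>
    some ⟨i.succ, ⟨0, by rw [h1 i]; exact one_pos⟩⟩
  -- The value `none` past the end of the arm is a dummy; only indices `j ≤ p` are used.
  let arm : ℕ → Option (Σ i, Fin (m i - 1)) := fun j =>
    if h : j < m 0 - 1 then some ⟨0, ⟨j, h⟩⟩ else none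
  have harm : ∀ j (hj : j ≤ p), arm j = some ⟨0, ⟨j, by omega⟩⟩ := fun j hj =>
    dif_pos (by omega)
  have hleafinj : Function.Injective leaf := by
    intro i j hij
    have h2 := congrArg Sigma.fst (Option.some.inj hij)
    exact Fin.succ_injective _ h2
  have hnils := realizes_nils (G := starlike m) (v := none) (Finset.univ.image leaf)
    (by simp [leaf])
    (by
      intro x hx
      obtain ⟨i, -, rfl⟩ := Finset.mem_image.1 hx
      exact (starlike_adj_none _).2 rfl)
    (by
      intro x hx y hy
      obtain ⟨i, -, rfl⟩ := Finset.mem_image.1 hx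
      obtain ⟨j, -, rfl⟩ := Finset.mem_image.1 hy
      rw [starlike_adj_some]
      simp)
  rw [Finset.card_image_of_injective _ hleafinj, Finset.card_univ, Fintype.card_fin] at hnils
  have hpath := realizes_path (G := starlike m) p arm
    (by
      intro i hi j hj h
      rw [harm i hi, harm j hj] at h
      simpa using h)
    (by
      intro i hi j hj
      rw [harm i hi, harm j hj, starlike_adj_some]
      simp)
  have hu : (Finset.univ : Finset (Option (Σ i, Fin (m i - 1)))) =
      insert none (Finset.univ.image leaf) ∪ (Finset.range (p + 1)).image arm := by
    refine (Finset.eq_univ_iff_forall.2 fun x => ?_).symm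
    rw [Finset.mem_union, Finset.mem_insert, Finset.mem_image, Finset.mem_image]
    rcases x with _ | ⟨i, j⟩
    · exact Or.inl (Or.inl rfl)
    · induction i using Fin.cases with
      | zero =>
        have := j.2
        refine Or.inr ⟨j, Finset.mem_range.2 (by omega), ?_⟩
        rw [harm j (by omega)]
      | succ i =>
        refine Or.inl (Or.inr ⟨i, Finset.mem_univ _, ?_⟩)
        have h2 : (⟨0, by rw [h1 i]; exact one_pos⟩ : Fin (m i.succ - 1)) = j := by
          have h3 := h1 i
          ext
          have := j.2
          simp only
          omega
        simp only [leaf, h2]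
  rw [hu]
  refine .cons hnils hpath ?_ ?_
  · rw [Finset.disjoint_right]
    intro x hx hx'
    obtain ⟨j, hj, rfl⟩ := Finset.mem_image.1 hx
    rw [harm j (by simpa [Nat.lt_succ_iff] using hj), Finset.mem_insert, Finset.mem_image] at hx'
    rcases hx' with h | ⟨i, -, h⟩
    · cases h
    · have h2 := congrArg Sigma.fst (Option.some.inj h)
      exact Fin.succ_ne_zero i h2
  · intro x hx y hy
    obtain ⟨j, hj, rfl⟩ := Finset.mem_image.1 hy
    rw [harm j (by simpa [Nat.lt_succ_iff] using hj), harm 0 (by omega)]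
    rw [Finset.mem_insert, Finset.mem_image] at hx
    rcases hx with rfl | ⟨i, -, rfl⟩
    · rw [starlike_adj_none]
      simp
    · rw [starlike_adj_some]
      simp [leaf, Fin.succ_ne_zero]

lemma realizes_treeT {n k : ℕ} (hk : 1 ≤ k) (hkn : k + 1 ≤ n) :
    Realizes (treeT n k) (PlaneForest.cons (path (n - k - 1)) (nils (k - 1))) none Finset.univ := by
  obtain ⟨K, rfl⟩ : ∃ K, k = K + 1 := ⟨k - 1, by omega⟩
  refine realizes_starlike ?_ ?_
  · simp only [longArm, Fin.val_zero, if_true]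
    omega
  · intro i
    simp [longArm]

lemma realizes_doubleStar (a b : ℕ) :
    Realizes (doubleStar a b) (PlaneForest.cons (nils b) (nils a)) (.inl false) Finset.univ := by
  have hadj : ∀ x y, (doubleStar a b).Adj x y ↔ x ≠ y ∧ _ := fun x y => fromRel_adj _ x y
  have h1 := realizes_nils (G := doubleStar a b) (v := .inl false)
    ((Finset.univ : Finset (Fin a)).image fun i => .inr (.inl i)) (by simp)
    (by simp [hadj]) (by simp [hadj])
  have h2 := realizes_nils (G := doubleStar a b) (v := .inl true)
    ((Finset.univ : Finset (Fin b)).image fun i => .inr (.inr i)) (by simp)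
    (by simp [hadj]) (by simp [hadj])
  rw [Finset.card_image_of_injective _ (fun i j h => by simpa using h), Finset.card_univ,
    Fintype.card_fin] at h1 h2
  have hu : (Finset.univ : Finset (Bool ⊕ (Fin a ⊕ Fin b))) =
      insert (.inl false) (Finset.univ.image fun i => .inr (.inl i)) ∪
        insert (.inl true) (Finset.univ.image fun i => .inr (.inr i)) := by
    ext x
    rcases x with (_ | _) | _ | _ <;> simp
  rw [hu]
  refine .cons h1 h2 ?_ ?_
  · rw [Finset.disjoint_left]
    rintro ((_ | _) | _ | _) <;> simp
  · rintro ((_ | _) | _ | _) hx ((_ | _) | _ | _) hy <;> simp [hadj] at hx hy ⊢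

/-! ### From plane forests to the order on graphs -/

/-- The comparison is needed only strictly between `0` and the first zero `τ ≤ 1 / 2`; continuity
adds both endpoints. -/
lemma indepGE_of_realizes {V W : Type*} [Fintype V] [Fintype W] [DecidableEq V] [DecidableEq W]
    {G : SimpleGraph V} {H : SimpleGraph W} {f g : PlaneForest} {v : V} {w : W}
    (hG : Realizes G f v Finset.univ) (hH : Realizes H g w Finset.univ) (hf : f ≠ .nil)
    (hle : ∀ t, 0 < t → t < 1 / 2 → (∀ s ≤ t, 0 < tree s f) → tree t f ≤ tree t g) :
    IndepGE G H := by
  obtain ⟨τ, h0, h1, hroot, hpos⟩ := hG.exists_isLargestRoot hf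
  refine ⟨-τ, hroot, ?_⟩
  have hsub : closure (Set.Ioo 0 τ) ⊆ {t | tree t f ≤ tree t g} :=
    closure_minimal (fun t ht => hle t ht.1 (ht.2.trans_le h1) fun s hs => hpos s (hs.trans_lt ht.2))
      (isClosed_le (continuous_tree f) (continuous_tree g))
  rw [closure_Ioo h0.ne] at hsub
  intro x hx
  have h2 := hsub (⟨by linarith [hx.2], by linarith [hx.1]⟩ : -x ∈ Set.Icc 0 τ)
  rw [← neg_neg x, hG.eval_indepPoly, hH.eval_indepPoly]
  exact h2

lemma Realizes.exists_tree_pos {V : Type*} [Fintype V] [DecidableEq V] {G : SimpleGraph V}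
    {f : PlaneForest} {v : V} (hG : Realizes G f v Finset.univ) (hf : f ≠ .nil) :
    ∃ t, 0 < t ∧ t < 1 ∧ ∀ s ≤ t, 0 < tree s f := by
  obtain ⟨τ, h0, h1, -, hpos⟩ := hG.exists_isLargestRoot hf
  exact ⟨τ / 2, by linarith, by linarith, fun s hs => hpos s (by linarith)⟩

lemma indepPoly_eq_of_iso {V W : Type*} [Fintype V] [Fintype W] [DecidableEq V] [DecidableEq W]
    {G : SimpleGraph V} {H : SimpleGraph W} {f : PlaneForest} {v : V} (e : G ≃g H)
    (hG : Realizes G f v Finset.univ) : indepPoly G = indepPoly H := by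
  have hH := hG.map_iso e
  rw [Finset.map_univ_equiv] at hH
  refine Polynomial.funext fun x => ?_
  rw [← neg_neg x, hG.eval_indepPoly, hH.eval_indepPoly]

lemma pos_cons_nil {f : PlaneForest} {t : ℝ} (ht : 0 < t) (h : ∀ s ≤ t, 0 < tree s f) :
    Pos t (.cons f .nil) :=
  ⟨h t le_rfl, pos_of_tree_pos f ht.le fun s hs => h s hs.2, trivial⟩

lemma IsTree.card_le_two_of_maxDegree_le_one {V : Type*} [Fintype V] {T : SimpleGraph V}
    [DecidableRel T.Adj] (hT : T.IsTree) (hk : T.maxDegree ≤ 1) : Fintype.card V ≤ 2 := by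
  classical
  have h1 := hT.card_edgeFinset
  have h2 := T.sum_degrees_eq_twice_card_edges
  have h3 : ∑ v, T.degree v ≤ ∑ _v : V, 1 :=
    Finset.sum_le_sum fun v _ => (T.degree_le_maxDegree v).trans hk
  simp only [Finset.sum_const, Finset.card_univ, smul_eq_mul, mul_one] at h3
  omega

/-- Below a vertex of maximum degree, a tree of order `n ≥ 2` is a forest with at least one tree. -/
lemma IsTree.exists_realizes_maxDegree {V : Type*} [Fintype V] [DecidableEq V] {T : SimpleGraph V}
    [DecidableRel T.Adj] (hT : T.IsTree) (hn : 2 ≤ Fintype.card V) :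
    ∃ v f, Realizes T f v Finset.univ ∧ f ≠ .nil ∧ deg f = T.maxDegree ∧ 1 ≤ T.maxDegree ∧
      T.maxDegree + 1 ≤ Fintype.card V ∧ inner f = Fintype.card V - T.maxDegree - 1 := by
  have : Nonempty V := Fintype.card_pos_iff.1 (by omega)
  obtain ⟨v, hv⟩ := T.exists_maximal_degree_vertex
  obtain ⟨f, hf⟩ := hT.exists_realizes v
  have hdeg : deg f = T.maxDegree := by rw [← hf.degree, ← hv]
  have hsize := hf.card
  rw [Finset.card_univ] at hsize
  have hin := size_eq f
  have hfnil : f ≠ .nil := by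
    rintro rfl
    simp [size] at hsize
    omega
  have hk : 1 ≤ T.maxDegree := by
    rw [← hdeg]
    cases f with
    | nil => exact absurd rfl hfnil
    | cons c r => simp [deg]
  exact ⟨v, f, hf, hfnil, hdeg, hk, by omega, by omega⟩

/-! ### The two halves of the theorem -/

lemma IsTree.indepGE_treeH {V : Type*} [Fintype V] {T : SimpleGraph V}
    [DecidableRel T.Adj] (hT : T.IsTree) (hn : 2 ≤ Fintype.card V) :
    IndepGE (treeH (Fintype.card V) T.maxDegree) T ∧
      (indepPoly (treeH (Fintype.card V) T.maxDegree) = indepPoly T ↔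
        Nonempty (T ≃g treeH (Fintype.card V) T.maxDegree)) := by
  classical
  obtain ⟨v, f, hf, hfnil, hdeg, -, -, hin⟩ := hT.exists_realizes_maxDegree hn
  have hH : Realizes (treeH (Fintype.card V) T.maxDegree)
      (.cons (nils (inner f)) (nils (deg f - 1))) (.inl false) Finset.univ := by
    rw [hin, hdeg]
    exact realizes_doubleStar _ _
  refine ⟨indepGE_of_realizes hH hf (by simp) fun t h0 h1 hpos => ?_, fun heq => ?_, fun ⟨e⟩ => ?_⟩
  · exact (lower_bound h0 (by linarith) hfnil (hpos t le_rfl)).1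
  · obtain ⟨t, h0, h1, hpos⟩ := hH.exists_tree_pos (by simp)
    have h2 := (lower_bound h0 h1 hfnil (hpos t le_rfl)).2
      (by rw [← hf.eval_indepPoly, ← hH.eval_indepPoly, heq])
    exact (hf.of_oneLong h2).nonempty_iso hH
  · exact (indepPoly_eq_of_iso e hf).symm

lemma IsTree.indepGE_treeT {V : Type*} [Fintype V] {T : SimpleGraph V}
    [DecidableRel T.Adj] (hT : T.IsTree) (hn : 2 ≤ Fintype.card V) :
    IndepGE T (treeT (Fintype.card V) T.maxDegree) ∧
      (indepPoly T = indepPoly (treeT (Fintype.card V) T.maxDegree) ↔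
        Nonempty (T ≃g treeT (Fintype.card V) T.maxDegree)) := by
  classical
  obtain ⟨v, f, hf, hfnil, hdeg, hk, hkn, hin⟩ := hT.exists_realizes_maxDegree hn
  have hTT : Realizes (treeT (Fintype.card V) T.maxDegree)
      (.cons (path (inner f)) (nils (deg f - 1))) none Finset.univ := by
    rw [hin, hdeg]
    exact realizes_treeT hk hkn
  refine ⟨indepGE_of_realizes hf hTT hfnil fun t h0 h1 hpos => ?_, fun heq => ?_, fun ⟨e⟩ => ?_⟩
  · exact (upper_bound h0 hfnil (pos_cons_nil h0 hpos)).1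
  · obtain ⟨t, h0, h1, hpos⟩ := hf.exists_tree_pos hfnil
    have h2 : tree t f = tree t (.cons (path (inner f)) (nils (deg f - 1))) := by
      rw [← hf.eval_indepPoly, ← hTT.eval_indepPoly, heq]
    -- The equality case of `upper_bound` requires degree at least two; otherwise the tree is a
    -- single edge.
    rcases Nat.lt_or_ge (deg f) 2 with hd | hd
    · have hcard := hT.card_le_two_of_maxDegree_le_one (by omega)
      have hsz := hf.card
      rw [Finset.card_univ] at hsz
      obtain ⟨c, r, rfl⟩ : ∃ c r, f = .cons c r := by
        cases f with
        | nil => exact absurd rfl hfnil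
        | cons c r => exact ⟨c, r, rfl⟩
      rw [size] at hsz
      have hc : c = .nil := eq_nil_of_size (by omega)
      have hr : r = .nil := eq_nil_of_size (by omega)
      subst hc hr
      exact hf.nonempty_iso hTT
    · rcases (upper_bound h0 hfnil (pos_cons_nil h0 hpos)).2 hd h2 with h3 | ⟨p, q, rfl⟩
      · exact (hf.of_oneLong h3).nonempty_iso hTT
      · obtain ⟨u, hu⟩ := hf.two_paths
        have h4 : inner (.cons (path p) (.cons (path q) .nil)) = p + q := by simp [PlaneForest.inner]
        have h5 : deg (.cons (path p) (.cons (path q) .nil)) - 1 = 1 := rfl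
        rw [h4, h5] at hTT
        exact hu.nonempty_iso hTT
  · exact indepPoly_eq_of_iso e hf

end SimpleGraph

theorem mainTheorem2 {V : Type*} [Fintype V] (T : SimpleGraph V) [DecidableRel T.Adj] (n k : ℕ)
    (hT : T.IsTree) (hn : Fintype.card V = n) (hn2 : 2 ≤ n) (hk : T.maxDegree = k) :
    IndepGE (treeH n k) T ∧ IndepGE T (treeT n k) ∧
      (indepPoly (treeH n k) = indepPoly T ↔ Nonempty (T ≃g treeH n k)) ∧
      (indepPoly T = indepPoly (treeT n k) ↔ Nonempty (T ≃g treeT n k)) := by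
  subst hn hk
  obtain ⟨h1, h2⟩ := hT.indepGE_treeH hn2
  obtain ⟨h3, h4⟩ := hT.indepGE_treeT hn2
  exact ⟨h1, h3, h2, h4⟩
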